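/- **Dimensions.** A dimension function is a map $\Phi:(0,1)\to[0,\infty)$ such that $x^{1+\Phi(x)}$ decreases to $0$ as $x$ decreases to $0$. It is called *large* if there are $\delta>0$ and a function $A$ with $A(x)\to\infty$ as $x\to0^+$ and $\Phi(x)\ge A(x)\,\frac{\log|\log x|}{|\log x|}$ for $0<x<\delta$, and *small* if there are such $\delta,A$ with $\frac{\log|\log x|}{|\log x|}\ge A(x)\Phi(x)$ for $0<x<\delta$. For a Borel probability measure $\mu$ on $\mathbb R^D$, the upper $\Phi$-dimension $\overline{\dim}_\Phi\mu\in[-\infty,\infty]$ is the infimum of the real numbers $d$ for which there are $C_1,C_2>0$ such that $\frac{\mu(B(x,R))}{\mu(B(x,\rho))}\le C_2(R/\rho)^d$ for all $x\in\operatorname{supp}\mu$ and all $0<\rho<R^{1+\Phi(R)}\le R\le C_1$ with $R<1$; the lower $\Phi$-dimension $\underline{\dim}_\Phi\mu$ is the supremum of those $d$ for which the same holds with $\ge$ in place of $\le$. Balls are open. **Random Moran measures.** Let $0<\tau<1$. A family $J_1,\dots,J_t$ of subsets of a set $I\subseteq\mathbb R^D$ is called a *$\tau$-separated family of $\rho$-similarities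 of $I$* if each $J_i$ is the image of $I$ under a similarity with contraction factor $\rho$, and $d(J_i,J_j)\ge\tau\rho\operatorname{diam}(I)$ for $i\ne j$. Let $I_0\subseteq\mathbb R^D$ be compact with diameter $1$ and non-empty interior, and for each $t\ge2$ let $r_t\in(0,1/2]$ be such that for every $0<\rho\le r_t$ such a family of $t$ subsets of $I_0$ exists. Put $\mathcal S_t=\{x\in\mathbb R^t:x_i>0,\ \sum_i x_i=1\}$, let $\Omega_0$ be the disjoint union over $t\ge2$ of the spaces $(0,r_t]\times\mathcal S_t$, let $\pi$ be a Borel probability measure on $\Omega_0$, and let $\mathbb P$ be the product measure on $\Omega=\Omega_0^{\mathbb N}$. A point $\omega\in\Omega$ is thus an iid sequence $(T_n,r_n,p_n)_{n\ge1}$, where $T_n\ge2$ is an integer, $r_n\in(0,r_{T_n}]$ and $p_n=(p_n^{(1)},\dots,p_n^{(T_n)})\in\mathcal S_{T_n}$. Given $\omega$, a Moran construction starts with $I_0$ as the only Moran set of step $0$, and selects from each Moran set $I$ of step $n$ a $\tau$-separated family $I^{(1)},\dots,I^{(T_{n+1})}\subseteq I$ of $r_{n+1}$-similarities of $I$; these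 are the Moran sets of step $n+1$. The Moran measure $\mu_\omega$ is the Borel probability measure with $\mu_\omega(I_0)=1$ and $\mu_\omega(I^{(j)})=\mu_\omega(I)\,p_{n+1}^{(j)}$ for every Moran set $I$ of step $n$ and every $j$. **Statement.** Suppose that the ratios are constant: $r_n=r$ almost surely, for a number $r$. Put $X_1=|\log\max_kp_1^{(k)}|$ and $Y_1=|\log\min_kp_1^{(k)}|$. There is a set $\Gamma\subseteq\Omega$ with $\mathbb P(\Gamma)=1$ such that the following holds for every $\omega\in\Gamma$ and every Moran construction for $\omega$. (i) $\mathbb E(X_1)<\infty$, and for all large dimension functions $\Phi$, $$\underline{\dim}_\Phi\mu_\omega=\frac{\mathbb E(X_1)}{|\log r|}.$$ If moreover there is $A>0$ with $\mathbb E(e^{\lambda Y_1})<\infty$ for all $|\lambda|\le A$, then $\mathbb E(Y_1)<\infty$, and for all large dimension functions $\Phi$, $$\overline{\dim}_\Phi\mu_\omega=\frac{\mathbb E(Y_1)}{|\log r|}.$$ (ii) For all small dimension functions $\Phi$, $$\underline{\dim}_\Phi\mu_\omega=\frac{\operatorname{ess\,inf}X_1}{|\log r|}\quad\text{and}\quad\overline{\dim}_\Phi\mu_\omega=\frac{\operatorname{ess\,sup}Y_1}{|\log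 r|},$$ where the essential supremum may be $+\infty$. -/

import Mathlib

open MeasureTheory Set Filter Topology

noncomputable section

namespace RandomMoran

/-! ### Dimension functions and the `Φ`-dimensions of a measure -/

/-- A dimension function `Φ : (0,1) → [0,∞)`: `x ^ (1 + Φ x)` decreases to `0` as `x` decreases
to `0`. Only the values of `Φ` on `(0,1)` are ever used. -/
structure IsDimensionFunction (Φ : ℝ → ℝ) : Prop where
  nonneg : ∀ x ∈ Ioo (0 : ℝ) 1, 0 ≤ Φ x
  monotoneOn : MonotoneOn (fun x => x ^ (1 + Φ x)) (Ioo (0 : ℝ) 1)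
  tendsto_zero : Tendsto (fun x => x ^ (1 + Φ x)) (𝓝[>] (0 : ℝ)) (𝓝 0)

/-- `f ≫ g` near `0`: there are `A` and `δ > 0` with `f x ≥ A x * g x` for `0 < x < δ` and
`A x → ∞` as `x → 0⁺`. -/
def MuchGreater (f g : ℝ → ℝ) : Prop :=
  ∃ (A : ℝ → ℝ) (δ : ℝ), 0 < δ ∧ (∀ x, 0 < x → x < δ → A x * g x ≤ f x) ∧
    Tendsto A (𝓝[>] (0 : ℝ)) atTop

/-- The threshold function `log |log x| / |log x|`. -/
def threshold (x : ℝ) : ℝ := Real.log |Real.log x| / |Real.log x|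

/-- `Φ` is a large dimension function: `Φ ≫ log |log x| / |log x|`. -/
def IsLarge (Φ : ℝ → ℝ) : Prop := IsDimensionFunction Φ ∧ MuchGreater Φ threshold

/-- `Φ` is a small dimension function: `Φ ≪ log |log x| / |log x|`. -/
def IsSmall (Φ : ℝ → ℝ) : Prop := IsDimensionFunction Φ ∧ MuchGreater threshold Φ

section PhiDim

variable {X : Type*} [MetricSpace X] [MeasurableSpace X]

/-- The upper `Φ`-dimension, the infimum of all admissible exponents (`+∞` if there are none). -/
def upperPhiDim (Φ : ℝ → ℝ) (μ : Measure X) : EReal :=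
  sInf ((fun d : ℝ => (d : EReal)) '' {d : ℝ | ∃ C₁ > (0 : ℝ), ∃ C₂ > (0 : ℝ), ∀ R r : ℝ,
    0 < r → r < R ^ (1 + Φ R) → R ^ (1 + Φ R) ≤ R → R < 1 → R ≤ C₁ → ∀ x ∈ μ.support,
      μ.real (Metric.ball x R) / μ.real (Metric.ball x r) ≤ C₂ * (R / r) ^ d})

/-- The lower `Φ`-dimension, the supremum of all admissible exponents. -/
def lowerPhiDim (Φ : ℝ → ℝ) (μ : Measure X) : EReal :=
  sSup ((fun d : ℝ => (d : EReal)) '' {d : ℝ | ∃ C₁ > (0 : ℝ), ∃ C₂ > (0 : ℝ), ∀ R r : ℝ,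
    0 < r → r < R ^ (1 + Φ R) → R ^ (1 + Φ R) ≤ R → R < 1 → R ≤ C₁ → ∀ x ∈ μ.support,
      C₂ * (R / r) ^ d ≤ μ.real (Metric.ball x R) / μ.real (Metric.ball x r)})

end PhiDim

/-! ### Separated families of similar copies -/

/-- `ℝ^D` with its Euclidean metric. -/
abbrev Space (D : ℕ) : Type := EuclideanSpace ℝ (Fin D)

/-- `J` is a `ρ`-similarity of `I`: the image of `I` under a similarity of contraction
factor `ρ`. -/
def IsSimilarCopy {D : ℕ} (ρ : ℝ) (I J : Set (Space D)) : Prop :=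
  ∃ f : Space D → Space D, (∀ x y, dist (f x) (f y) = ρ * dist x y) ∧ J = f '' I

/-- The sets `J i` are `ρ`-similarities of `I` contained in `I` and they are `τ`-separated:
distinct ones are at distance at least `τ * ρ * diam I`. -/
structure IsSeparatedFamily {D : ℕ} (τ ρ : ℝ) (I : Set (Space D)) {t : ℕ}
    (J : Fin t → Set (Space D)) : Prop where
  subset : ∀ i, J i ⊆ I
  similar : ∀ i, IsSimilarCopy ρ I (J i)
  separated : ∀ i j, i ≠ j → ∀ x ∈ J i, ∀ y ∈ J j, τ * ρ * Metric.diam I ≤ dist x y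

/-- The `(t, ρ, τ)`-separation property of `I`. -/
def HasSeparation {D : ℕ} (I : Set (Space D)) (t : ℕ) (ρ τ : ℝ) : Prop :=
  ∃ J : Fin t → Set (Space D), IsSeparatedFamily τ ρ I J

/-! ### The probability space -/

/-- The fixed deterministic data: a compact set `I₀ ⊆ ℝ^D` of diameter `1` with non-empty
interior, a number `0 < τ < 1`, and `r_t ∈ (0, 1/2]` for `t ≥ 2` such that `I₀` has the
`(t, ρ, τ)`-separation property for all `0 < ρ ≤ r_t`. -/
structure Setup (D : ℕ) where
  I₀ : Set (Space D)
  isCompact : IsCompact I₀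
  diam_eq : Metric.diam I₀ = 1
  interior_nonempty : (interior I₀).Nonempty
  τ : ℝ
  τ_pos : 0 < τ
  τ_lt_one : τ < 1
  rMax : ℕ → ℝ
  rMax_pos : ∀ t, 2 ≤ t → 0 < rMax t
  rMax_le : ∀ t, 2 ≤ t → rMax t ≤ 1 / 2
  separation : ∀ t, 2 ≤ t → ∀ ρ, 0 < ρ → ρ ≤ rMax t → HasSeparation I₀ t ρ τ

/-- The open probability simplex `{x ∈ ℝ^t : x_i > 0, ∑ x_i = 1}`. -/
def openSimplex (t : ℕ) : Set (Fin t → ℝ) := {x | (∀ i, 0 < x i) ∧ ∑ i, x i = 1}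

/-- The disjoint union over `t ≥ 2` of `(0, r_t] × openSimplex t`, with its Borel
`σ`-algebra. -/
abbrev Choice {D : ℕ} (S : Setup D) : Type :=
  Σ t : {t : ℕ // 2 ≤ t}, Ioc (0 : ℝ) (S.rMax t) × openSimplex t

variable {D : ℕ} {S : Setup D}

/-- The number of children. -/
def num (a : Choice S) : ℕ := a.1

/-- The ratio of the diameter of a child to that of its parent. -/
def ratio (a : Choice S) : ℝ := a.2.1

/-- The probability vector. -/
def prob (a : Choice S) : Fin (num a) → ℝ := a.2.2.1

/-- `|log max_k p^(k)|`. -/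
def absLogMax (a : Choice S) : ℝ := |Real.log (⨆ k, prob a k)|

/-- `|log min_k p^(k)|`. -/
def absLogMin (a : Choice S) : ℝ := |Real.log (⨅ k, prob a k)|

/-- The infinite product measure induced by `π`: under it the coordinates `ω n` are iid with
law `π`. -/
def productLaw (π : Measure (Choice S)) : Measure (ℕ → Choice S) :=
  Measure.infinitePi fun _ => π

lemma two_le_num (a : Choice S) : 2 ≤ num a := a.1.2

lemma ratio_pos (a : Choice S) : 0 < ratio a := a.2.1.2.1

lemma ratio_le (a : Choice S) : ratio a ≤ 1 / 2 :=
  a.2.1.2.2.trans (S.rMax_le _ a.1.2)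

lemma prob_pos (a : Choice S) (k : Fin (num a)) : 0 < prob a k := a.2.2.2.1 k

lemma sum_prob (a : Choice S) : ∑ k, prob a k = 1 := a.2.2.2.2

/-! ### Moran sets -/

/-- The addresses of the Moran sets of step `n`: the children of the set with address `w` have
the addresses `(w, j)`, where `j` ranges over the `T_{n+1}` labels. (`ω n` holds the data
`(T_{n+1}, r_{n+1}, p_{n+1})` of step `n + 1`.) -/
def Address (ω : ℕ → Choice S) : ℕ → Type
  | 0 => Unit
  | n + 1 => Address ω n × Fin (num (ω n))

/-- The mass of a Moran set: `μ(I₀) = 1` and `μ(I^(j)) = μ(I) * p_{n+1}^(j)`. -/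
def mass (ω : ℕ → Choice S) : (n : ℕ) → Address ω n → ℝ
  | 0, _ => 1
  | n + 1, w => mass ω n w.1 * prob (ω n) w.2

/-- A Moran construction for `ω`: a choice of the Moran sets of all steps. The set of step `0` is
`I₀`, and from each Moran set `I` of step `n` one selects `T_{n+1}` subsets that are
`r_{n+1}`-similarities of `I` and are `τ`-separated. -/
structure Moran (S : Setup D) (ω : ℕ → Choice S) where
  cell : (n : ℕ) → Address ω n → Set (Space D)
  cell_zero : ∀ w, cell 0 w = S.I₀
  children : ∀ (n : ℕ) (w : Address ω n), IsSeparatedFamily S.τ (ratio (ω n)) (cell n w)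
    (fun j => cell (n + 1) (w, j))

/-- The infinite codes. -/
abbrev Code (ω : ℕ → Choice S) : Type := (n : ℕ) → Fin (num (ω n))

/-- The address formed by the first `n` letters of a code. -/
def Code.trunc {ω : ℕ → Choice S} (x : Code ω) : (n : ℕ) → Address ω n
  | 0 => ()
  | n + 1 => (Code.trunc x n, x n)

namespace Moran

variable {ω : ℕ → Choice S} (M : Moran S ω)

lemma isSimilarCopy_cell (n : ℕ) (w : Address ω n) :
    ∃ ρ : ℝ, 0 < ρ ∧ ρ ≤ (1 / 2) ^ n ∧ IsSimilarCopy ρ S.I₀ (M.cell n w) := by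
  induction n with
  | zero => exact ⟨1, one_pos, by simp, id, by simp, by simp [M.cell_zero]⟩
  | succ n ih =>
    obtain ⟨v, j⟩ := w
    obtain ⟨ρ, h0, h1, f, hf, hc⟩ := ih v
    obtain ⟨g, hg, hd⟩ := (M.children n v).similar j
    refine ⟨ratio (ω n) * ρ, mul_pos (ratio_pos _) h0, ?_, g ∘ f, ?_, ?_⟩
    · rw [pow_succ, mul_comm]
      exact mul_le_mul h1 (ratio_le _) (ratio_pos _).le (by positivity)
    · intro x y; simp [hg, hf, mul_assoc]
    · rw [image_comp, ← hc]; exact hd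

lemma I₀_nonempty (S : Setup D) : S.I₀.Nonempty :=
  S.interior_nonempty.mono interior_subset

lemma cell_nonempty (n : ℕ) (w : Address ω n) : (M.cell n w).Nonempty := by
  obtain ⟨ρ, -, -, f, -, hc⟩ := M.isSimilarCopy_cell n w
  rw [hc]; exact (I₀_nonempty S).image f

lemma isCompact_cell (n : ℕ) (w : Address ω n) : IsCompact (M.cell n w) := by
  obtain ⟨ρ, h0, -, f, hf, hc⟩ := M.isSimilarCopy_cell n w
  rw [hc]
  refine S.isCompact.image (LipschitzWith.continuous (K := ρ.toNNReal) ?_)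
  refine LipschitzWith.of_dist_le_mul fun x y => ?_
  rw [hf, Real.coe_toNNReal _ h0.le]

lemma dist_le_of_mem_cell {n : ℕ} {w : Address ω n} {x y : Space D} (hx : x ∈ M.cell n w)
    (hy : y ∈ M.cell n w) : dist x y ≤ (1 / 2) ^ n := by
  obtain ⟨ρ, h0, h1, f, hf, hc⟩ := M.isSimilarCopy_cell n w
  rw [hc] at hx hy
  obtain ⟨a, ha, rfl⟩ := hx
  obtain ⟨b, hb, rfl⟩ := hy
  have := Metric.dist_le_diam_of_mem S.isCompact.isBounded ha hb
  rw [S.diam_eq] at this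
  rw [hf]
  calc ρ * dist a b ≤ ρ * 1 := by gcongr
    _ ≤ _ := by simpa using h1

lemma diam_cell_pos (n : ℕ) (w : Address ω n) : 0 < Metric.diam (M.cell n w) := by
  have hne : ∃ a ∈ S.I₀, ∃ b ∈ S.I₀, a ≠ b := by
    by_contra! h
    have : S.I₀.Subsingleton := fun a ha b hb => h a ha b hb
    have := Metric.diam_subsingleton this
    rw [S.diam_eq] at this
    exact one_ne_zero this
  obtain ⟨a, ha, b, hb, hab⟩ := hne
  obtain ⟨ρ, h0, h1, f, hf, hc⟩ := M.isSimilarCopy_cell n w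
  have h := Metric.dist_le_diam_of_mem (M.isCompact_cell n w).isBounded
    (x := f a) (y := f b) (by rw [hc]; exact mem_image_of_mem f ha)
    (by rw [hc]; exact mem_image_of_mem f hb)
  refine lt_of_lt_of_le ?_ h
  rw [hf]
  exact mul_pos h0 (dist_pos.2 hab)

lemma exists_point (x : Code ω) : ∃ y : Space D, ∀ n, y ∈ M.cell n (x.trunc n) := by
  have := IsCompact.nonempty_iInter_of_sequence_nonempty_isCompact_isClosed
    (fun n => M.cell n (x.trunc n))
    (fun n => (M.children n (x.trunc n)).subset (x n))
    (fun n => M.cell_nonempty n _) (M.isCompact_cell 0 _)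
    (fun n => (M.isCompact_cell n _).isClosed)
  obtain ⟨y, hy⟩ := this
  exact ⟨y, fun n => mem_iInter.1 hy n⟩

/-- The point with code `x`: the unique element of the intersection over `n` of the Moran sets of
step `n` addressed by `x`. -/
def point (x : Code ω) : Space D := (M.exists_point x).choose

lemma point_mem (x : Code ω) (n : ℕ) : M.point x ∈ M.cell n (x.trunc n) :=
  (M.exists_point x).choose_spec n

lemma cell_disjoint {n : ℕ} {v w : Address ω n} {y : Space D} (hv : y ∈ M.cell n v)
    (hw : y ∈ M.cell n w) : v = w := by
  induction n with
  | zero => rfl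
  | succ n ih =>
    obtain ⟨v, i⟩ := v
    obtain ⟨w, j⟩ := w
    obtain rfl := ih ((M.children n v).subset i hv) ((M.children n w).subset j hw)
    by_contra hne
    have hij : i ≠ j := fun h => hne (by rw [h])
    have h := (M.children n v).separated i j hij y hv y hw
    rw [dist_self] at h
    exact absurd h (not_le.2 (mul_pos (mul_pos S.τ_pos (ratio_pos _)) (M.diam_cell_pos n v)))

end Moran

/-! ### The random Moran measure -/

/-- The law on the labels `{0, …, T - 1}` with the given probability vector. -/
def labelLaw (a : Choice S) : Measure (Fin (num a)) :=
  ∑ k, ENNReal.ofReal (prob a k) • Measure.dirac k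

lemma labelLaw_singleton (a : Choice S) (k : Fin (num a)) :
    labelLaw a {k} = ENNReal.ofReal (prob a k) := by
  classical
  simp only [labelLaw, Measure.finsetSum_apply, Measure.smul_apply, smul_eq_mul]
  rw [Finset.sum_eq_single k] <;> simp +contextual

instance (a : Choice S) : IsProbabilityMeasure (labelLaw a) := ⟨by
  simp only [labelLaw, Measure.finsetSum_apply, Measure.smul_apply, smul_eq_mul, measure_univ,
    mul_one]
  rw [← ENNReal.ofReal_sum_of_nonneg fun k _ => (prob_pos a k).le, sum_prob, ENNReal.ofReal_one]⟩

lemma trunc_eq_iff {ω : ℕ → Choice S} (x y : Code ω) (n : ℕ) :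
    x.trunc n = y.trunc n ↔ ∀ k ∈ Finset.range n, x k = y k := by
  induction n with
  | zero => exact ⟨fun _ => by simp, fun _ => rfl⟩
  | succ n ih =>
    have : x.trunc (n + 1) = y.trunc (n + 1) ↔ x.trunc n = y.trunc n ∧ x n = y n :=
      Prod.mk_inj
    rw [this, ih, Finset.range_add_one]
    simp [and_comm]

namespace Moran

variable {ω : ℕ → Choice S} (M : Moran S ω)

/-- The Moran measure: the image, under the coding map, of the product of the laws on the labels.
It is the Borel probability measure that gives each Moran set its mass
(see `Moran.measure_cell`). -/
def measure : Measure (Space D) :=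
  (Measure.infinitePi fun n => labelLaw (ω n)).map M.point

lemma measurable_point : Measurable M.point := by
  refine Continuous.measurable (continuous_iff_continuousAt.2 fun x => ?_)
  rw [ContinuousAt, Metric.tendsto_nhds]
  intro ε hε
  obtain ⟨n, hn⟩ := exists_pow_lt_of_lt_one hε (by norm_num : (1 / 2 : ℝ) < 1)
  have hU : {y : Code ω | ∀ k ∈ Finset.range n, y k = x k} ∈ 𝓝 x := by
    have : {y : Code ω | ∀ k ∈ Finset.range n, y k = x k}
        = (Finset.range n : Set ℕ).pi fun k => {x k} := by
      ext y; simp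
    rw [this]
    exact (isOpen_set_pi (Finset.range n).finite_toSet fun k _ => isOpen_discrete _).mem_nhds
      (by simp)
  filter_upwards [hU] with y hy
  refine lt_of_le_of_lt (M.dist_le_of_mem_cell (w := x.trunc n) ?_ (M.point_mem x n)) hn
  rw [← (trunc_eq_iff y x n).2 hy]
  exact M.point_mem y n

instance : IsProbabilityMeasure M.measure :=
  Measure.isProbabilityMeasure_map M.measurable_point.aemeasurable

lemma exists_code {ω : ℕ → Choice S} (n : ℕ) (w : Address ω n) :
    ∃ x : Code ω, x.trunc n = w ∧ mass ω n w = ∏ k ∈ Finset.range n, prob (ω k) (x k) := by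
  induction n with
  | zero => exact ⟨fun k => ⟨0, by have := two_le_num (ω k); omega⟩, rfl, by simp [mass]⟩
  | succ n ih =>
    obtain ⟨v, j⟩ := w
    obtain ⟨x, hx, hm⟩ := ih v
    have hxy : ∀ k ∈ Finset.range n, Function.update x n j k = x k := fun k hk =>
      Function.update_of_ne (Finset.mem_range.1 hk).ne _ _
    refine ⟨Function.update x n j, ?_, ?_⟩
    · refine Prod.ext_iff.2 ⟨((trunc_eq_iff _ _ n).2 hxy).trans hx, ?_⟩
      exact Function.update_self (f := x) n j
    · rw [Finset.prod_range_succ, Finset.prod_congr rfl fun k hk => by rw [hxy k hk],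
        Function.update_self, ← hm]
      rfl

/-- The Moran measure obeys the rule `μ(I₀) = 1` and `μ(I^(j)) = μ(I) * p_{n+1}^(j)`. -/
theorem measure_cell (n : ℕ) (w : Address ω n) :
    M.measure (M.cell n w) = ENNReal.ofReal (mass ω n w) := by
  obtain ⟨x, rfl, hm⟩ := exists_code n w
  rw [measure, Measure.map_apply M.measurable_point (M.isCompact_cell n _).measurableSet]
  have : M.point ⁻¹' M.cell n (x.trunc n) = (Finset.range n : Set ℕ).pi fun k => {x k} := by
    ext y
    have h : y ∈ M.point ⁻¹' M.cell n (x.trunc n) ↔ y.trunc n = x.trunc n :=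
      ⟨fun hy => M.cell_disjoint (M.point_mem y n) hy, fun hy => by
        rw [mem_preimage, ← hy]; exact M.point_mem y n⟩
    rw [h, trunc_eq_iff]
    simp
  rw [this, Measure.infinitePi_pi _ (fun k _ => MeasurableSet.singleton _), hm,
    ENNReal.ofReal_prod_of_nonneg fun k _ => (prob_pos _ _).le]
  exact Finset.prod_congr rfl fun k _ => labelLaw_singleton _ _

end Moran

end RandomMoran

end

noncomputable section

namespace RandomMoran

variable {D : ℕ} {S : Setup D}

/-! ### The largest and the smallest probability -/

/-! With a constant ratio every cell of step `n` has diameter `r ^ n`, and distinct cells of step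
`n` are at least `τ * r ^ n` apart. Hence a ball of radius `R` about a coded point has the mass of a
cell with `r ^ n ≈ R`, up to a bounded shift of `n`, and the quotient of two concentric balls is the
exponential of a sum of `-log p` over a window `[n, m)` of steps. Each summand lies between `X` and
`Y`; the code that always takes the largest probability gives exactly the sum of `X`, the one that
always takes the smallest gives the sum of `Y`. So the lower and upper dimensions are the extreme
averages of `X` and of `Y` over the windows that `Φ` admits (`le_lowerPhiDim`, `lowerPhiDim_le`,
`upperPhiDim_le`, `le_upperPhiDim`).

Since `n ≈ |log R| / |log r|`, the threshold corresponds to windows of length about `log n`. A large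
`Φ` admits only windows longer than every multiple of `log n`. By Chernoff's bound a window of
length `k` has an average away from the mean with probability at most `θ ^ k`, `θ < 1`; this is
summable over all `n` and all `k ≥ K log n`, so Borel–Cantelli turns all late averages into the mean
(`exists_ae_window_sum_le`). A small `Φ` admits windows of length `κ log n` for every `κ > 0`. For
`κ` small, the second Borel–Cantelli lemma yields infinitely many such windows filled with values
near the essential extremum (`exists_ae_frequently_run`), while the opposite bound holds term by
term.

The moment condition is needed for `Y` only: a fixed ratio bounds the number of children by packing,
so `X` is essentially bounded. The random events concern only the sequence `ω` and rational levels,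
so one null set serves all `Φ` and all Moran constructions. -/

instance (a : Choice S) : Nonempty (Fin (num a)) := ⟨⟨0, by have := two_le_num a; omega⟩⟩

lemma prob_le_one (a : Choice S) (k : Fin (num a)) : prob a k ≤ 1 :=
  (Finset.single_le_sum (f := prob a) (fun i _ => (prob_pos a i).le) (Finset.mem_univ k)).trans_eq
    (sum_prob a)

lemma exists_neg_log_prob_eq_absLogMax (a : Choice S) :
    ∃ k, -Real.log (prob a k) = absLogMax a := by
  obtain ⟨k, hk⟩ := exists_eq_ciSup_of_finite (f := prob a)
  refine ⟨k, ?_⟩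
  rw [absLogMax, ← hk, abs_of_nonpos (Real.log_nonpos (prob_pos a k).le (prob_le_one a k))]

lemma exists_neg_log_prob_eq_absLogMin (a : Choice S) :
    ∃ k, -Real.log (prob a k) = absLogMin a := by
  obtain ⟨k, hk⟩ := exists_eq_ciInf_of_finite (f := prob a)
  refine ⟨k, ?_⟩
  rw [absLogMin, ← hk, abs_of_nonpos (Real.log_nonpos (prob_pos a k).le (prob_le_one a k))]

lemma absLogMax_le (a : Choice S) (k : Fin (num a)) : absLogMax a ≤ -Real.log (prob a k) := by
  have h : prob a k ≤ ⨆ k, prob a k := le_ciSup (Set.finite_range _).bddAbove k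
  rw [absLogMax, abs_of_nonpos (Real.log_nonpos ((prob_pos a k).le.trans h)
    (ciSup_le fun k => prob_le_one a k))]
  exact neg_le_neg (Real.log_le_log (prob_pos a k) h)

lemma le_absLogMin (a : Choice S) (k : Fin (num a)) : -Real.log (prob a k) ≤ absLogMin a := by
  have h : ⨅ k, prob a k ≤ prob a k := ciInf_le (Set.finite_range _).bddBelow k
  obtain ⟨j, hj⟩ := exists_eq_ciInf_of_finite (f := prob a)
  have h0 : 0 < ⨅ k, prob a k := hj ▸ prob_pos a j
  rw [absLogMin, abs_of_nonpos (Real.log_nonpos h0.le (h.trans (prob_le_one a k)))]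
  exact neg_le_neg (Real.log_le_log h0 h)

lemma absLogMax_nonneg (a : Choice S) : 0 ≤ absLogMax a := abs_nonneg _

lemma absLogMin_nonneg (a : Choice S) : 0 ≤ absLogMin a := abs_nonneg _

/-! ### Masses of cells -/

/-- The product of the first `n` probabilities along a code. -/
def weight {ω : ℕ → Choice S} (x : Code ω) (n : ℕ) : ℝ :=
  ∏ k ∈ Finset.range n, prob (ω k) (x k)

lemma mass_trunc {ω : ℕ → Choice S} (x : Code ω) (n : ℕ) :
    mass ω n (x.trunc n) = weight x n := by
  induction n with
  | zero => simp [mass, weight]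
  | succ n ih => rw [weight, Finset.prod_range_succ, ← weight, ← ih]; rfl

lemma weight_pos {ω : ℕ → Choice S} (x : Code ω) (n : ℕ) : 0 < weight x n :=
  Finset.prod_pos fun _ _ => prob_pos _ _

lemma weight_div_weight {ω : ℕ → Choice S} (x : Code ω) {n m : ℕ} (h : n ≤ m) :
    weight x n / weight x m = Real.exp (∑ k ∈ Finset.Ico n m, -Real.log (prob (ω k) (x k))) := by
  rw [Real.exp_sum, div_eq_iff (weight_pos x m).ne']
  have h2 : weight x m = weight x n * ∏ k ∈ Finset.Ico n m, prob (ω k) (x k) :=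
    (Finset.prod_range_mul_prod_Ico _ h).symm
  rw [h2, mul_left_comm, ← Finset.prod_mul_distrib, Finset.prod_eq_one, mul_one]
  intro k _
  rw [Real.exp_neg, Real.exp_log (prob_pos _ _), inv_mul_cancel₀ (prob_pos _ _).ne']

namespace Moran

variable {ω : ℕ → Choice S} (M : Moran S ω) {r : ℝ}

/-! ### Geometry of Moran constructions with a constant ratio -/

lemma isSimilarCopy_cell_pow (hω : ∀ n, ratio (ω n) = r) (n : ℕ) (w : Address ω n) :
    IsSimilarCopy (r ^ n) S.I₀ (M.cell n w) := by
  induction n with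
  | zero => exact ⟨id, by simp, by simp [M.cell_zero]⟩
  | succ n ih =>
    obtain ⟨v, j⟩ := w
    obtain ⟨f, hf, hc⟩ := ih v
    obtain ⟨g, hg, hd⟩ := (M.children n v).similar j
    refine ⟨g ∘ f, fun x y => ?_, ?_⟩
    · simp [hg, hf, hω, pow_succ]; ring
    · rw [image_comp, ← hc]; exact hd

lemma dist_le_pow (hr : 0 < r) (hω : ∀ n, ratio (ω n) = r) {n : ℕ} {w : Address ω n}
    {x y : Space D} (hx : x ∈ M.cell n w) (hy : y ∈ M.cell n w) : dist x y ≤ r ^ n := by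
  obtain ⟨f, hf, hc⟩ := M.isSimilarCopy_cell_pow hω n w
  rw [hc] at hx hy
  obtain ⟨a, ha, rfl⟩ := hx
  obtain ⟨b, hb, rfl⟩ := hy
  have := Metric.dist_le_diam_of_mem S.isCompact.isBounded ha hb
  rw [S.diam_eq] at this
  rw [hf]
  exact mul_le_of_le_one_right (pow_pos hr n).le this

lemma pow_le_diam_cell (hr : 0 < r) (hω : ∀ n, ratio (ω n) = r) (n : ℕ) (w : Address ω n) :
    r ^ n ≤ Metric.diam (M.cell n w) := by
  obtain ⟨f, hf, hc⟩ := M.isSimilarCopy_cell_pow hω n w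
  have hn := pow_pos hr n
  have h : Metric.diam S.I₀ ≤ Metric.diam (M.cell n w) / r ^ n := by
    refine Metric.diam_le_of_forall_dist_le (by positivity) fun x hx y hy => ?_
    rw [le_div_iff₀' hn, ← hf]
    exact Metric.dist_le_diam_of_mem (M.isCompact_cell n w).isBounded
      (hc ▸ mem_image_of_mem f hx) (hc ▸ mem_image_of_mem f hy)
  rwa [S.diam_eq, le_div_iff₀' hn, mul_one] at h

/-- Siblings are separated relative to the diameter of their parent, which is at least `r ^ n`;
cells with different parents inherit the larger gap between the parents. -/
lemma separated_pow (hr : 0 < r) (hr1 : r ≤ 1) (hω : ∀ n, ratio (ω n) = r) {n : ℕ}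
    {v w : Address ω n} (hvw : v ≠ w) {x y : Space D} (hx : x ∈ M.cell n v)
    (hy : y ∈ M.cell n w) : S.τ * r ^ n ≤ dist x y := by
  induction n with
  | zero => exact absurd rfl hvw
  | succ n ih =>
    obtain ⟨v, i⟩ := v
    obtain ⟨w, j⟩ := w
    have hx' := (M.children n v).subset i hx
    have hy' := (M.children n w).subset j hy
    by_cases h : v = w
    · subst h
      have hij : i ≠ j := fun h => hvw (by rw [h])
      refine le_trans ?_ ((M.children n v).separated i j hij x hx y hy)
      rw [hω, pow_succ, mul_assoc, mul_comm _ r]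
      have := M.pow_le_diam_cell hr hω n v
      have := S.τ_pos
      gcongr
    · refine le_trans ?_ (ih h hx' hy')
      have := S.τ_pos
      exact mul_le_mul_of_nonneg_left (pow_le_pow_of_le_one hr.le hr1 n.le_succ) this.le

lemma continuous_point : Continuous M.point := by
  refine continuous_iff_continuousAt.2 fun x => ?_
  rw [ContinuousAt, Metric.tendsto_nhds]
  intro ε hε
  obtain ⟨n, hn⟩ := exists_pow_lt_of_lt_one hε (by norm_num : (1 / 2 : ℝ) < 1)
  have hU : {y : Code ω | ∀ k ∈ Finset.range n, y k = x k} ∈ 𝓝 x := by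
    have : {y : Code ω | ∀ k ∈ Finset.range n, y k = x k}
        = (Finset.range n : Set ℕ).pi fun k => {x k} := by
      ext y; simp
    rw [this]
    exact (isOpen_set_pi (Finset.range n).finite_toSet fun k _ => isOpen_discrete _).mem_nhds
      (by simp)
  filter_upwards [hU] with y hy
  refine lt_of_le_of_lt (M.dist_le_of_mem_cell (w := x.trunc n) ?_ (M.point_mem x n)) hn
  rw [← (trunc_eq_iff y x n).2 hy]
  exact M.point_mem y n

/-- The range of the coding map is compact and carries the measure. Bounds over the support thus
reduce to bounds over codes. -/
lemma support_subset_range : M.measure.support ⊆ range M.point := by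
  refine Measure.support_subset_of_isClosed (isCompact_range M.continuous_point).isClosed ?_
  rw [mem_ae_iff, measure, Measure.map_apply M.measurable_point
    (isCompact_range M.continuous_point).isClosed.measurableSet.compl]
  simp

lemma real_measure_cell (x : Code ω) (n : ℕ) :
    M.measure.real (M.cell n (x.trunc n)) = weight x n := by
  rw [Measure.real, measure_cell, mass_trunc, ENNReal.toReal_ofReal (weight_pos x n).le]

lemma weight_le_ball (hr : 0 < r) (hω : ∀ n, ratio (ω n) = r) (x : Code ω) {n : ℕ} {R : ℝ}
    (h : r ^ n < R) : weight x n ≤ M.measure.real (Metric.ball (M.point x) R) := by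
  rw [← M.real_measure_cell]
  refine measureReal_mono fun y hy => ?_
  exact (M.dist_le_pow hr hω hy (M.point_mem x n)).trans_lt h

lemma ball_le_weight (hr : 0 < r) (hr1 : r ≤ 1) (hω : ∀ n, ratio (ω n) = r) (x : Code ω)
    {n : ℕ} {R : ℝ} (h : R ≤ S.τ * r ^ n) :
    M.measure.real (Metric.ball (M.point x) R) ≤ weight x n := by
  -- The comparison is made between sets of codes: a cell also contains points without a code, and
  -- the ball need not lie inside the cell.
  rw [← M.real_measure_cell, measure, map_measureReal_apply M.measurable_point
    Metric.isOpen_ball.measurableSet, map_measureReal_apply M.measurable_point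
    (M.isCompact_cell n _).measurableSet]
  refine measureReal_mono fun y hy => ?_
  have hy' : dist (M.point y) (M.point x) < R := hy
  have : y.trunc n = x.trunc n := by
    by_contra hne
    exact absurd (M.separated_pow hr hr1 hω hne (M.point_mem y n) (M.point_mem x n))
      (not_le.2 (hy'.trans_le h))
  rw [mem_preimage, ← this]
  exact M.point_mem y n

lemma ball_point_pos (x : Code ω) {R : ℝ} (hR : 0 < R) :
    0 < M.measure.real (Metric.ball (M.point x) R) := by
  obtain ⟨n, hn⟩ := exists_pow_lt_of_lt_one hR (by norm_num : (1 / 2 : ℝ) < 1)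
  refine (weight_pos x n).trans_le ?_
  rw [← M.real_measure_cell]
  exact measureReal_mono fun y hy => (M.dist_le_of_mem_cell hy (M.point_mem x n)).trans_lt hn

lemma point_mem_support (x : Code ω) : M.point x ∈ M.measure.support := by
  rw [Measure.mem_support_iff_forall]
  intro U hU
  obtain ⟨ε, hε, hU⟩ := Metric.mem_nhds_iff.1 hU
  exact (ENNReal.toReal_pos_iff.1 (M.ball_point_pos x hε)).1.trans_le (measure_mono hU)

end Moran

end RandomMoran

end

noncomputable section

namespace RandomMoran

variable {D : ℕ} {S : Setup D}

namespace IsDimensionFunction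

lemma rpow_le {Φ : ℝ → ℝ} (h : IsDimensionFunction Φ) {R : ℝ} (h0 : 0 < R) (h1 : R < 1) :
    R ^ (1 + Φ R) ≤ R := by
  simpa using Real.rpow_le_rpow_of_exponent_ge h0 h1.le
    (show 1 ≤ 1 + Φ R by have := h.nonneg R ⟨h0, h1⟩; linarith)

end IsDimensionFunction

namespace Moran

variable {ω : ℕ → Choice S} (M : Moran S ω) {r : ℝ}

/-! ### Ratios of the masses of concentric balls -/

lemma exp_sum_absLogMax_le (hr : 0 < r) (hr1 : r ≤ 1) (hω : ∀ n, ratio (ω n) = r) (x : Code ω)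
    {n m : ℕ} (hnm : n ≤ m) {R ρ : ℝ} (hρ : 0 < ρ) (hn : r ^ n < R) (hm : ρ ≤ S.τ * r ^ m) :
    Real.exp (∑ k ∈ Finset.Ico n m, absLogMax (ω k)) ≤
      M.measure.real (Metric.ball (M.point x) R) / M.measure.real (Metric.ball (M.point x) ρ) := by
  refine le_trans ?_ (div_le_div₀ measureReal_nonneg (M.weight_le_ball hr hω x hn)
    (M.ball_point_pos x hρ) (M.ball_le_weight hr hr1 hω x hm))
  rw [weight_div_weight x hnm]
  gcongr
  exact absLogMax_le _ _

lemma le_exp_sum_absLogMin (hr : 0 < r) (hr1 : r ≤ 1) (hω : ∀ n, ratio (ω n) = r) (x : Code ω)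
    {n m : ℕ} (hnm : n ≤ m) {R ρ : ℝ} (hn : R ≤ S.τ * r ^ n) (hm : r ^ m < ρ) :
    M.measure.real (Metric.ball (M.point x) R) / M.measure.real (Metric.ball (M.point x) ρ) ≤
      Real.exp (∑ k ∈ Finset.Ico n m, absLogMin (ω k)) := by
  refine (div_le_div₀ (weight_pos x n).le (M.ball_le_weight hr hr1 hω x hn)
    (weight_pos x m) (M.weight_le_ball hr hω x hm)).trans ?_
  rw [weight_div_weight x hnm]
  gcongr
  exact le_absLogMin _ _

/-- A single code, with the most likely label at every step, is extremal for all windows at once. -/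
lemma exists_le_exp_sum_absLogMax (hr : 0 < r) (hr1 : r ≤ 1) (hω : ∀ n, ratio (ω n) = r) :
    ∃ x ∈ M.measure.support, ∀ n m : ℕ, n ≤ m → ∀ R ρ : ℝ, R ≤ S.τ * r ^ n → r ^ m < ρ →
      M.measure.real (Metric.ball x R) / M.measure.real (Metric.ball x ρ) ≤
        Real.exp (∑ k ∈ Finset.Ico n m, absLogMax (ω k)) := by
  choose x hx using fun n => exists_neg_log_prob_eq_absLogMax (ω n)
  refine ⟨M.point x, M.point_mem_support x, fun n m hnm R ρ hn hm => ?_⟩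
  refine (div_le_div₀ (weight_pos x n).le (M.ball_le_weight hr hr1 hω x hn)
    (weight_pos x m) (M.weight_le_ball hr hω x hm)).trans ?_
  simp_rw [weight_div_weight x hnm, hx, le_refl]

lemma exists_exp_sum_absLogMin_le (hr : 0 < r) (hr1 : r ≤ 1) (hω : ∀ n, ratio (ω n) = r) :
    ∃ x ∈ M.measure.support, ∀ n m : ℕ, n ≤ m → ∀ R ρ : ℝ, 0 < ρ → r ^ n < R →
      ρ ≤ S.τ * r ^ m → Real.exp (∑ k ∈ Finset.Ico n m, absLogMin (ω k)) ≤
        M.measure.real (Metric.ball x R) / M.measure.real (Metric.ball x ρ) := by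
  choose x hx using fun n => exists_neg_log_prob_eq_absLogMin (ω n)
  refine ⟨M.point x, M.point_mem_support x, fun n m hnm R ρ hρ hn hm => ?_⟩
  refine le_trans ?_ (div_le_div₀ measureReal_nonneg (M.weight_le_ball hr hω x hn)
    (M.ball_point_pos x hρ) (M.ball_le_weight hr hr1 hω x hm))
  simp_rw [weight_div_weight x hnm, hx, le_refl]

/-! ### Dimension bounds from sums over windows -/

lemma zero_le_lowerPhiDim {Φ : ℝ → ℝ} : 0 ≤ lowerPhiDim Φ M.measure := by
  refine le_sSup ⟨0, ⟨1, one_pos, 1, one_pos, fun R ρ h0 h1 h2 _ _ x hx => ?_⟩, rfl⟩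
  obtain ⟨x, rfl⟩ := M.support_subset_range hx
  rw [Real.rpow_zero, one_mul, one_le_div (M.ball_point_pos x h0)]
  exact measureReal_mono (Metric.ball_subset_ball (h1.trans_le h2).le)

/-- The window is chosen from inside: the cell of its first step lies in the large ball and the
small ball sees only the cell of its last step. The rounding of the radii costs a constant factor in
`R / ρ`, which `C₂` absorbs, so no unbounded `-log p` enters through the ends. -/
lemma le_lowerPhiDim (hr : 0 < r) (hr1 : r < 1) (hω : ∀ n, ratio (ω n) = r) {Φ : ℝ → ℝ} {d : ℝ}
    (hd : 0 ≤ d) {C₁ : ℝ} (hC₁ : 0 < C₁)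
    (H : ∀ (R ρ : ℝ) (n m : ℕ), 0 < ρ → ρ < R ^ (1 + Φ R) → 0 < R → R ≤ C₁ → n ≤ m →
      S.τ * r * r ^ n ≤ R → R ≤ r⁻¹ * r ^ n → S.τ * r * r ^ m ≤ ρ →
      d * |Real.log r| * (m - n) ≤ ∑ k ∈ Finset.Ico n m, absLogMax (ω k)) :
    (d : EReal) ≤ lowerPhiDim Φ M.measure := by
  have hτ := S.τ_pos
  have hτ1 := S.τ_lt_one
  set l := |Real.log r| with hl
  have hlr : Real.log r = -l := by rw [hl, abs_of_neg (Real.log_neg hr hr1), neg_neg]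
  refine le_sSup ⟨d, ⟨min C₁ S.τ, lt_min hC₁ hτ, Real.exp (-(d * (l - Real.log (S.τ * r)))),
    Real.exp_pos _, fun R ρ hρ h1 h2 hR1 hRC x hx => ?_⟩, rfl⟩
  have hρR : ρ < R := h1.trans_le h2
  have hR : 0 < R := hρ.trans hρR
  obtain ⟨x, rfl⟩ := M.support_subset_range hx
  obtain ⟨n, hn1, hn2⟩ := exists_nat_pow_near_of_lt_one hR hR1.le hr hr1
  obtain ⟨m, hm1, hm2⟩ := exists_nat_pow_near_of_lt_one (div_pos hρ hτ)
    ((div_le_one hτ).2 (hρR.le.trans (hRC.trans (min_le_right _ _)))) hr hr1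
  rw [lt_div_iff₀ hτ] at hm1
  rw [div_le_iff₀ hτ] at hm2
  have hRle : R ≤ r⁻¹ * r ^ (n + 1) := by
    rw [pow_succ, mul_comm, mul_assoc, mul_inv_cancel₀ hr.ne', mul_one]; exact hn2
  have hρge : S.τ * r * r ^ m ≤ ρ := by rw [pow_succ] at hm1; linarith
  have hlog : Real.log (R / ρ) ≤ l - Real.log (S.τ * r) + l * (m - (n + 1 : ℕ)) := by
    rw [Real.log_div hR.ne' hρ.ne']
    have e1 := Real.log_le_log hR hRle
    have e2 := Real.log_le_log (by positivity) hρge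
    rw [Real.log_mul (by positivity) (by positivity), Real.log_pow, Real.log_inv, hlr] at e1
    rw [Real.log_mul (by positivity) (by positivity), Real.log_pow, hlr] at e2
    linarith
  have hle : Real.exp (-(d * (l - Real.log (S.τ * r)))) * (R / ρ) ^ d ≤
      Real.exp (d * l * (m - (n + 1 : ℕ))) := by
    rw [Real.rpow_def_of_pos (div_pos hR hρ), ← Real.exp_add, Real.exp_le_exp]
    nlinarith [mul_le_mul_of_nonneg_left hlog hd]
  refine hle.trans ?_
  rcases le_total (n + 1) m with hnm | hnm
  · refine le_trans (Real.exp_le_exp.2 ?_)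
      (M.exp_sum_absLogMax_le hr hr1.le hω x hnm hρ hn1 (by linarith))
    refine H R ρ (n + 1) m hρ h1 hR (hRC.trans (min_le_left _ _)) hnm ?_ hRle hρge
    refine le_trans ?_ hn1.le
    exact mul_le_of_le_one_left (by positivity) (mul_le_one₀ hτ1.le hr.le hr1.le)
  -- For radii too close together the window is empty; then the required bound is at most `1`, and
  -- monotonicity of balls suffices.
  · refine le_trans (Real.exp_le_one_iff.2 ?_) ((one_le_div (M.ball_point_pos x hρ)).2
      (measureReal_mono (Metric.ball_subset_ball hρR.le)))
    have : (m : ℝ) ≤ (n + 1 : ℕ) := by exact_mod_cast hnm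
    exact mul_nonpos_of_nonneg_of_nonpos (by positivity) (by linarith)

/-- Here the window is chosen from outside: the large ball sees only the first cell and the small
ball contains the last one. -/
lemma upperPhiDim_le (hr : 0 < r) (hr1 : r < 1) (hω : ∀ n, ratio (ω n) = r) {Φ : ℝ → ℝ} {d : ℝ}
    (hd : 0 ≤ d) {C₁ : ℝ} (hC₁ : 0 < C₁)
    (H : ∀ (R ρ : ℝ) (n m : ℕ), 0 < ρ → ρ < R ^ (1 + Φ R) → 0 < R → R ≤ C₁ → n ≤ m →
      S.τ * r * r ^ n ≤ R → R ≤ r⁻¹ * r ^ n → S.τ * r * r ^ m ≤ ρ →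
      ∑ k ∈ Finset.Ico n m, absLogMin (ω k) ≤ d * |Real.log r| * (m - n)) :
    upperPhiDim Φ M.measure ≤ (d : EReal) := by
  have hτ := S.τ_pos
  have hτ1 := S.τ_lt_one
  set l := |Real.log r| with hl
  have hlr : Real.log r = -l := by rw [hl, abs_of_neg (Real.log_neg hr hr1), neg_neg]
  refine sInf_le ⟨d, ⟨min C₁ S.τ, lt_min hC₁ hτ, Real.exp (d * (l - Real.log (S.τ * r))),
    Real.exp_pos _, fun R ρ hρ h1 h2 hR1 hRC x hx => ?_⟩, rfl⟩
  have hρR : ρ < R := h1.trans_le h2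
  have hR : 0 < R := hρ.trans hρR
  obtain ⟨x, rfl⟩ := M.support_subset_range hx
  obtain ⟨n, hn1, hn2⟩ := exists_nat_pow_near_of_lt_one (div_pos hR hτ)
    ((div_le_one hτ).2 (hRC.trans (min_le_right _ _))) hr hr1
  obtain ⟨m, hm1, hm2⟩ := exists_nat_pow_near_of_lt_one hρ (hρR.le.trans hR1.le) hr hr1
  rw [lt_div_iff₀ hτ] at hn1
  rw [div_le_iff₀ hτ] at hn2
  have hρle : ρ ≤ r⁻¹ * r ^ (m + 1) := by
    rw [pow_succ, mul_comm, mul_assoc, mul_inv_cancel₀ hr.ne', mul_one]; exact hm2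
  have hRge : S.τ * r * r ^ n ≤ R := by rw [pow_succ] at hn1; linarith
  have hrn := pow_pos hr n
  have hRn : R ≤ r ^ n := hn2.trans (mul_le_of_le_one_right hrn.le hτ1.le)
  have hnm : n ≤ m + 1 := (pow_lt_pow_iff_right_of_lt_one₀ hr hr1).1
    (hm1.trans (hρR.trans_le hRn)) |>.le
  have hlog : Real.log (S.τ * r) - l + l * ((m + 1 : ℕ) - n) ≤ Real.log (R / ρ) := by
    rw [Real.log_div hR.ne' hρ.ne']
    have e1 := Real.log_le_log hρ hρle
    have e2 := Real.log_le_log (by positivity) hRge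
    rw [Real.log_mul (by positivity) (by positivity), Real.log_pow, Real.log_inv, hlr] at e1
    rw [Real.log_mul (by positivity) (by positivity), Real.log_pow, hlr] at e2
    linarith
  refine (M.le_exp_sum_absLogMin hr hr1.le hω x hnm (by linarith) hm1).trans ?_
  rw [Real.rpow_def_of_pos (div_pos hR hρ), ← Real.exp_add, Real.exp_le_exp]
  refine (H R ρ n (m + 1) hρ h1 hR (hRC.trans (min_le_left _ _)) hnm hRge ?_ ?_).trans ?_
  · refine hRn.trans (le_mul_of_one_le_left hrn.le (one_le_inv₀ hr |>.2 hr1.le))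
  · refine le_trans ?_ hm1.le
    exact mul_le_of_le_one_left (by positivity) (mul_le_one₀ hτ1.le hr.le hr1.le)
  · nlinarith [mul_le_mul_of_nonneg_left hlog hd]

/-- An affine function of slope `> 0` is not bounded above along the natural numbers. -/
lemma exists_nat_forall_lt_mul {a : ℝ} (ha : 0 < a) (b : ℝ) :
    ∃ B : ℕ, ∀ x : ℝ, B ≤ x → b < a * x := by
  obtain ⟨B, hB⟩ := exists_nat_gt (b / a)
  exact ⟨B, fun x hx => (div_lt_iff₀' ha).1 (hB.trans_le hx)⟩

lemma exists_nat_forall_mul_pow_le (hr : 0 < r) (hr1 : r < 1) {c : ℝ} (hc : 0 < c) {ε : ℝ}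
    (hε : 0 < ε) : ∃ B : ℕ, ∀ n, B ≤ n → c * r ^ n ≤ ε := by
  obtain ⟨B, hB⟩ := exists_pow_lt_of_lt_one (div_pos hε hc) hr1
  refine ⟨B, fun n hn => ?_⟩
  rw [← le_div_iff₀' hc]
  exact (pow_le_pow_of_le_one hr.le hr1.le hn).trans hB.le

lemma lowerPhiDim_le (hr : 0 < r) (hr1 : r < 1) (hω : ∀ n, ratio (ω n) = r) {Φ : ℝ → ℝ}
    (hΦ : IsDimensionFunction Φ) {c : ℝ}
    (H : ∀ B : ℕ, ∃ n m : ℕ, B ≤ n ∧ n + B ≤ m ∧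
      2 * r ^ m < (S.τ * r ^ n) ^ (1 + Φ (S.τ * r ^ n)) ∧
      ∑ k ∈ Finset.Ico n m, absLogMax (ω k) ≤ c * (m - n)) :
    lowerPhiDim Φ M.measure ≤ ((c / |Real.log r| : ℝ) : EReal) := by
  have hτ := S.τ_pos
  have hτ1 := S.τ_lt_one
  set l := |Real.log r| with hl
  have hlr : Real.log r = -l := by rw [hl, abs_of_neg (Real.log_neg hr hr1), neg_neg]
  have hl0 : 0 < l := abs_pos.2 (Real.log_neg hr hr1).ne
  refine sSup_le ?_
  rintro _ ⟨d, ⟨C₁, hC₁, C₂, hC₂, hd⟩, rfl⟩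
  rw [EReal.coe_le_coe_iff, le_div_iff₀ hl0]
  by_contra! hlt
  -- An exponent with `d * l > c` would bound `(d * l - c) * (m - n)` by this constant, which long
  -- windows refute.
  obtain ⟨B₁, hB₁⟩ := exists_nat_forall_lt_mul (sub_pos.2 hlt)
    (-Real.log C₂ - d * Real.log (S.τ / 2))
  obtain ⟨B₂, hB₂⟩ := exists_nat_forall_mul_pow_le hr hr1 hτ hC₁
  obtain ⟨n, m, hn, hm, h1, h2⟩ := H (max B₁ B₂)
  have hnm : n ≤ m := by omega
  have hrn := pow_pos hr n
  have hrm := pow_pos hr m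
  have hR : 0 < S.τ * r ^ n := by positivity
  have hR1 : S.τ * r ^ n < 1 := by nlinarith [pow_le_one₀ hr.le hr1.le (n := n)]
  obtain ⟨x, hx, hxle⟩ := M.exists_le_exp_sum_absLogMax hr hr1.le hω
  -- The factor `2` in the small radius gives the strict inequality `r ^ m < ρ` under which an open
  -- ball contains the cell.
  have h3 := (hd (S.τ * r ^ n) (2 * r ^ m) (by positivity) h1 (hΦ.rpow_le hR hR1) hR1
    (hB₂ n ((le_max_right _ _).trans hn)) x hx).trans
    ((hxle n m hnm _ _ le_rfl (by linarith)).trans (Real.exp_le_exp.2 h2))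
  have h4 := Real.log_le_log (by positivity) h3
  have h5 : Real.log (S.τ * r ^ n / (2 * r ^ m)) = Real.log (S.τ / 2) + l * (m - n) := by
    rw [Real.log_div hR.ne' (by positivity), Real.log_mul hτ.ne' hrn.ne',
      Real.log_mul two_ne_zero hrm.ne', Real.log_div hτ.ne' two_ne_zero, Real.log_pow,
      Real.log_pow, hlr]
    ring
  rw [Real.log_exp, Real.log_mul hC₂.ne' (by positivity), Real.log_rpow (by positivity), h5] at h4
  have h6 := hB₁ ((m : ℝ) - n) (by
    have : ((n + max B₁ B₂ : ℕ) : ℝ) ≤ m := by exact_mod_cast hm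
    have h7 : (B₁ : ℝ) ≤ (max B₁ B₂ : ℕ) := by exact_mod_cast le_max_left _ _
    push_cast at this h7; linarith)
  nlinarith

lemma le_upperPhiDim (hr : 0 < r) (hr1 : r < 1) (hω : ∀ n, ratio (ω n) = r) {Φ : ℝ → ℝ}
    (hΦ : IsDimensionFunction Φ) {c : ℝ}
    (H : ∀ B : ℕ, ∃ n m : ℕ, B ≤ n ∧ n + B ≤ m ∧
      S.τ * r ^ m < (2 * r ^ n) ^ (1 + Φ (2 * r ^ n)) ∧
      c * (m - n) ≤ ∑ k ∈ Finset.Ico n m, absLogMin (ω k)) :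
    ((c / |Real.log r| : ℝ) : EReal) ≤ upperPhiDim Φ M.measure := by
  have hτ := S.τ_pos
  have hτ1 := S.τ_lt_one
  set l := |Real.log r| with hl
  have hlr : Real.log r = -l := by rw [hl, abs_of_neg (Real.log_neg hr hr1), neg_neg]
  have hl0 : 0 < l := abs_pos.2 (Real.log_neg hr hr1).ne
  refine le_sInf ?_
  rintro _ ⟨d, ⟨C₁, hC₁, C₂, hC₂, hd⟩, rfl⟩
  rw [EReal.coe_le_coe_iff, div_le_iff₀ hl0]
  by_contra! hlt
  obtain ⟨B₁, hB₁⟩ := exists_nat_forall_lt_mul (sub_pos.2 hlt)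
    (Real.log C₂ + d * Real.log (2 / S.τ))
  obtain ⟨B₂, hB₂⟩ := exists_nat_forall_mul_pow_le hr hr1 two_pos
    -- The bound `1 / 2` keeps the large radius `2 * r ^ n` below `1`.
    (lt_min hC₁ (by norm_num : (0 : ℝ) < 1 / 2))
  obtain ⟨n, m, hn, hm, h1, h2⟩ := H (max B₁ B₂)
  have hnm : n ≤ m := by omega
  have hrn := pow_pos hr n
  have hrm := pow_pos hr m
  have hR : 0 < 2 * r ^ n := by positivity
  have hRC := hB₂ n ((le_max_right _ _).trans hn)
  have hR1 : 2 * r ^ n < 1 := by linarith [hRC.trans (min_le_right _ _)]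
  obtain ⟨x, hx, hxle⟩ := M.exists_exp_sum_absLogMin_le hr hr1.le hω
  have h3 := ((Real.exp_le_exp.2 h2).trans (hxle n m hnm _ _ (by positivity) (by linarith)
    le_rfl)).trans (hd (2 * r ^ n) (S.τ * r ^ m) (by positivity) h1 (hΦ.rpow_le hR hR1) hR1
    (hRC.trans (min_le_left _ _)) x hx)
  have h4 := Real.log_le_log (by positivity) h3
  have h5 : Real.log (2 * r ^ n / (S.τ * r ^ m)) = Real.log (2 / S.τ) + l * (m - n) := by
    rw [Real.log_div hR.ne' (by positivity), Real.log_mul two_ne_zero hrn.ne',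
      Real.log_mul hτ.ne' hrm.ne', Real.log_div two_ne_zero hτ.ne', Real.log_pow,
      Real.log_pow, hlr]
    ring
  rw [Real.log_exp, Real.log_mul hC₂.ne' (by positivity), Real.log_rpow (by positivity), h5] at h4
  have h6 := hB₁ ((m : ℝ) - n) (by
    have : ((n + max B₁ B₂ : ℕ) : ℝ) ≤ m := by exact_mod_cast hm
    have h7 : (B₁ : ℝ) ≤ (max B₁ B₂ : ℕ) := by exact_mod_cast le_max_left _ _
    push_cast at this h7; linarith)
  nlinarith

end Moran

end RandomMoran

end

noncomputable section

namespace RandomMoran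

/-! ### Window lengths for large and small dimension functions -/

lemma IsLarge.exists_forall_window {Φ : ℝ → ℝ} (h : IsLarge Φ) {r : ℝ} (hr : 0 < r)
    (hr1 : r < 1) {a b : ℝ} (ha : 0 < a) (hb : 0 < b) {K : ℝ} (hK : 0 ≤ K) (n₀ : ℕ) :
    ∃ C₁ : ℝ, 0 < C₁ ∧ ∀ (R ρ : ℝ) (n m : ℕ), 0 < ρ → ρ < R ^ (1 + Φ R) → 0 < R → R ≤ C₁ →
      a * r ^ n ≤ R → R ≤ b * r ^ n → a * r ^ m ≤ ρ →
      n₀ ≤ n ∧ K * Real.log (n + 1) ≤ m - n := by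
  obtain ⟨-, A, δ, hδ, hA, hAt⟩ := h
  set l := |Real.log r| with hl
  have hlr : Real.log r = -l := by rw [hl, abs_of_neg (Real.log_neg hr hr1), neg_neg]
  have hl0 : 0 < l := abs_pos.2 (Real.log_neg hr hr1).ne
  have hu : Tendsto (fun R => -Real.log R) (𝓝[>] (0 : ℝ)) atTop :=
    tendsto_neg_atBot_atTop.comp Real.tendsto_log_nhdsGT_zero
  -- With `u = -log R`, the window has `l * (m - n) ≥ Φ R * u + log a - log b`. The part `2 * K * l`
  -- of the lower bound for `A` pays for `K * l * log (n + 1)`, because `n + 1 ≤ u ^ 2`; the extra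
  -- `1` pays for `log b - log a`.
  have hev : ∀ᶠ R in 𝓝[>] (0 : ℝ), R < δ ∧ 2 * K * l + 1 ≤ A R ∧ 1 < -Real.log R ∧
      (|Real.log b| + 1) / l + 1 ≤ -Real.log R ∧ n₀ * l - Real.log a ≤ -Real.log R ∧
      Real.log b - Real.log a ≤ Real.log (-Real.log R) :=
    (show ∀ᶠ R in 𝓝[>] (0 : ℝ), R < δ from nhdsWithin_le_nhds (Iio_mem_nhds hδ)).and <| (hAt.eventually_ge_atTop _).and <|
      (hu.eventually_gt_atTop _).and <| (hu.eventually_ge_atTop _).and <|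
      (hu.eventually_ge_atTop _).and <| (Real.tendsto_log_atTop.comp hu).eventually_ge_atTop _
  obtain ⟨C, hC, hCs⟩ := mem_nhdsGT_iff_exists_Ioc_subset.1 hev
  refine ⟨C, hC, fun R ρ n m hρ h1 hR hRC h2 h3 h4 => ?_⟩
  obtain ⟨e1, e2, e3, e4, e5, e6⟩ := hCs ⟨hR, hRC⟩
  have hAR := hA R hR e1
  set u := -Real.log R with hu
  have hRu : Real.log R = -u := by rw [hu, neg_neg]
  have hu0 : 0 < u := one_pos.trans e3
  have hlu : 0 < Real.log u := Real.log_pos e3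
  rw [threshold, hRu, abs_neg, abs_of_pos hu0] at hAR
  have hΦ : (2 * K * l + 1) * Real.log u ≤ Φ R * u := by
    have := mul_le_mul_of_nonneg_right hAR hu0.le
    rw [mul_assoc, div_mul_cancel₀ _ hu0.ne'] at this
    exact (mul_le_mul_of_nonneg_right e2 hlu.le).trans this
  have f2 := Real.log_le_log (by positivity) h2
  have f3 := Real.log_le_log hR h3
  have f4 := Real.log_lt_log (by positivity) (h4.trans_lt h1)
  rw [Real.log_mul (by positivity) (by positivity), Real.log_pow, hlr, hRu] at f2 f3
  rw [Real.log_mul (by positivity) (by positivity), Real.log_pow, Real.log_rpow hR, hlr, hRu] at f4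
  constructor
  · have : (n₀ : ℝ) * l ≤ n * l := by linarith
    exact_mod_cast le_of_mul_le_mul_right this hl0
  · have g1 : (n : ℝ) + 1 ≤ u ^ 2 := by
      have g2 : (n : ℝ) ≤ u * ((|Real.log b| + 1) / l) := by
        rw [← mul_div_assoc, le_div_iff₀ hl0]
        nlinarith [le_abs_self (Real.log b), abs_nonneg (Real.log b)]
      nlinarith
    have g3 := Real.log_le_log (by positivity) g1
    rw [Real.log_pow] at g3
    have g4 : K * Real.log (n + 1) * l ≤ (m - n) * l := by
      have := mul_le_mul_of_nonneg_left g3 (mul_nonneg hK hl0.le)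
      push_cast at this
      linarith
    exact le_of_mul_le_mul_right g4 hl0

lemma IsSmall.eventually_lt_rpow {Φ : ℝ → ℝ} (h : IsSmall Φ) {r : ℝ} (hr : 0 < r)
    (hr1 : r < 1) {a b : ℝ} (ha : 0 < a) (hb : 0 < b) {κ : ℝ} (hκ : 0 < κ) :
    ∀ᶠ n : ℕ in atTop, ∀ m : ℕ, n + κ * Real.log n ≤ m →
      a * r ^ m < (b * r ^ n) ^ (1 + Φ (b * r ^ n)) := by
  obtain ⟨hdim, A, δ, hδ, hA, hAt⟩ := h
  set l := |Real.log r| with hl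
  have hlr : Real.log r = -l := by rw [hl, abs_of_neg (Real.log_neg hr hr1), neg_neg]
  have hl0 : 0 < l := abs_pos.2 (Real.log_neg hr hr1).ne
  have hlog : Tendsto (fun n : ℕ => Real.log n) atTop atTop :=
    Real.tendsto_log_atTop.comp tendsto_natCast_atTop_atTop
  have hR0 : Tendsto (fun n : ℕ => b * r ^ n) atTop (𝓝[>] 0) := by
    refine tendsto_nhdsWithin_iff.2 ⟨?_, Eventually.of_forall fun n => mul_pos hb (pow_pos hr n)⟩
    simpa using (tendsto_pow_atTop_nhds_zero_of_lt_one hr.le hr1).const_mul b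
  have hu : Tendsto (fun R => -Real.log R) (𝓝[>] (0 : ℝ)) atTop :=
    tendsto_neg_atBot_atTop.comp Real.tendsto_log_nhdsGT_zero
  -- As `u ≤ n ^ 2`, the bound `4 / (κ * l)` makes `Φ R * u` at most half of `κ * l * log n`; the
  -- other half absorbs `log a - log b`.
  filter_upwards [hR0.eventually (nhdsWithin_le_nhds (Iio_mem_nhds hδ)),
    (hAt.comp hR0).eventually_ge_atTop (4 / (κ * l)), (hu.comp hR0).eventually_gt_atTop 1,
    tendsto_natCast_atTop_atTop.eventually_ge_atTop (l + |Real.log b|),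
    hlog.eventually_gt_atTop ((Real.log a - Real.log b) / (κ * l / 2)),
    eventually_ge_atTop 1] with n e1 e2 e3 e4 e5 e6 m hm
  have e1 : b * r ^ n < δ := e1
  simp only [Function.comp] at e2 e3
  have hn1 : (1 : ℝ) ≤ n := by exact_mod_cast e6
  have hR : 0 < b * r ^ n := by positivity
  have hRlog : Real.log (b * r ^ n) = Real.log b - n * l := by
    rw [Real.log_mul (by positivity) (by positivity), Real.log_pow, hlr]; ring
  set R := b * r ^ n with hRdef
  have hR1 : R < 1 := by
    by_contra! h1
    linarith [Real.log_nonneg h1]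
  have hΦ0 := hdim.nonneg R ⟨hR, hR1⟩
  have hAR := hA R hR e1
  set u := -Real.log R with hu
  have hRu : Real.log R = -u := by rw [hu, neg_neg]
  have hu0 : 0 < u := one_pos.trans e3
  rw [threshold, hRu, abs_neg, abs_of_pos hu0] at hAR
  have g1 : u ≤ (n : ℝ) ^ 2 := by
    nlinarith [neg_le_abs (Real.log b), abs_nonneg (Real.log b)]
  have g2 : Real.log u ≤ 2 * Real.log n := by
    simpa [Real.log_pow] using Real.log_le_log hu0 g1
  have g3 : Φ R * u ≤ κ * l / 2 * Real.log n := by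
    have := mul_le_mul_of_nonneg_right ((mul_le_mul_of_nonneg_right e2 hΦ0).trans hAR) hu0.le
    rw [div_mul_cancel₀ _ hu0.ne', div_mul_eq_mul_div, div_mul_eq_mul_div,
      div_le_iff₀ (by positivity)] at this
    nlinarith [mul_le_mul_of_nonneg_right g2 (by positivity : 0 ≤ κ * l)]
  rw [div_lt_iff₀ (by positivity)] at e5
  rw [← Real.log_lt_log_iff (by positivity) (by positivity), Real.log_rpow hR,
    Real.log_mul (by positivity) (by positivity), Real.log_pow, hlr, hRu]
  nlinarith [mul_le_mul_of_nonneg_right hm hl0.le]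

end RandomMoran

end

noncomputable section

namespace RandomMoran

open ProbabilityTheory

section IID

variable {α : Type*} [MeasurableSpace α] {π : Measure α}

/-! ### Upper deviations of sums over windows -/

lemma zero_mem_interior_integrableExpSet {f : α → ℝ} {A : ℝ} (hA : 0 < A)
    (hf : ∀ l : ℝ, |l| ≤ A → Integrable (fun a => Real.exp (l * f a)) π) :
    0 ∈ interior (integrableExpSet f π) := by
  refine mem_interior_iff_mem_nhds.2 (mem_of_superset (Metric.ball_mem_nhds 0 hA) fun l hl => ?_)
  rw [mem_ball_zero_iff, Real.norm_eq_abs] at hl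
  exact hf l hl.le

lemma zero_mem_interior_integrableExpSet_neg {f : α → ℝ} {A : ℝ} (hA : 0 < A)
    (hf : ∀ l : ℝ, |l| ≤ A → Integrable (fun a => Real.exp (l * f a)) π) :
    0 ∈ interior (integrableExpSet (fun a => -f a) π) :=
  zero_mem_interior_integrableExpSet hA fun l hl => by
    simpa only [neg_mul_comm] using hf (-l) (by rwa [abs_neg])

variable [IsProbabilityMeasure π]

/-- The function of `l` equals `1` at `0` and has there the derivative `E f - c < 0`. -/
lemma exists_exp_mul_mgf_lt_one {f : α → ℝ} (hf : 0 ∈ interior (integrableExpSet f π)) {c : ℝ}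
    (hc : ∫ a, f a ∂π < c) :
    ∃ l : ℝ, 0 < l ∧ l ∈ integrableExpSet f π ∧ Real.exp (-l * c) * mgf f π l < 1 := by
  have hd : HasDerivAt (fun l => Real.exp (-l * c) * mgf f π l) (-c + ∫ a, f a ∂π) 0 := by
    have h1 : HasDerivAt (fun l : ℝ => Real.exp (-l * c)) (Real.exp (-0 * c) * (-1 * c)) 0 :=
      (((hasDerivAt_id (0 : ℝ)).neg).mul_const c).exp
    have h2 := h1.mul (hasDerivAt_mgf hf)
    have h3 : Real.exp (-0 * c) * (-1 * c) * mgf f π 0 +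
        Real.exp (-0 * c) * ∫ a, f a * Real.exp (0 * f a) ∂π = -c + ∫ a, f a ∂π := by simp
    rw [← h3]
    exact h2
  have hs := (hasDerivAt_iff_tendsto_slope.1 hd).mono_left
    (nhdsWithin_mono 0 (fun x (hx : 0 < x) => hx.ne') : 𝓝[>] (0 : ℝ) ≤ 𝓝[≠] 0)
  have hev := (hs.eventually_lt_const (by linarith : -c + ∫ a, f a ∂π < 0)).and
    ((show ∀ᶠ l in 𝓝[>] (0 : ℝ), 0 < l from self_mem_nhdsWithin).and (nhdsWithin_le_nhds (mem_interior_iff_mem_nhds.1 hf)))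
  obtain ⟨l, h1, h2, h3⟩ := hev.exists
  have h2 : 0 < l := h2
  refine ⟨l, h2, h3, ?_⟩
  rw [slope_def_field, sub_zero, div_lt_iff₀ h2] at h1
  simp at h1 ⊢
  linarith

lemma measureReal_window_le {f : α → ℝ} (hf : Measurable f) {l : ℝ} (hl : 0 < l)
    (hfl : l ∈ integrableExpSet f π) (c : ℝ) (n k : ℕ) :
    (Measure.infinitePi fun _ : ℕ => π).real
        {ω | c * k ≤ ∑ i ∈ Finset.Ico n (n + k), f (ω i)} ≤
      (Real.exp (-l * c) * mgf f π l) ^ k := by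
  set P := Measure.infinitePi fun _ : ℕ => π with hP
  set X : ℕ → (ℕ → α) → ℝ := fun i ω => f (ω i) with hX
  have hXm : ∀ i, Measurable (X i) := fun i => hf.comp (measurable_pi_apply i)
  have hind : iIndepFun X P := iIndepFun_infinitePi (X := fun _ => f) fun _ => hf
  have hmp : ∀ i, MeasurePreserving (fun ω : ℕ → α => ω i) P π :=
    fun i => measurePreserving_eval_infinitePi (fun _ : ℕ => π) i
  have hint : ∀ i, Integrable (fun ω => Real.exp (l * X i ω)) P := fun i =>
    (hmp i).integrable_comp_of_integrable hfl
  have hmgf : ∀ i, mgf (X i) P l = mgf f π l := fun i => by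
    have := mgf_map (μ := P) (X := f) (hmp i).aemeasurable (t := l)
      (by rw [(hmp i).map_eq]; exact hfl.aestronglyMeasurable)
    rw [(hmp i).map_eq] at this
    exact this.symm
  have h1 := measure_ge_le_exp_mul_mgf (c * k) hl.le
    (hind.integrable_exp_mul_sum hXm (s := Finset.Ico n (n + k)) fun i _ => hint i)
  rw [hind.mgf_sum hXm, Finset.prod_congr rfl fun i _ => hmgf i, Finset.prod_const,
    Nat.card_Ico, Nat.add_sub_cancel_left] at h1
  rw [mul_pow, ← Real.exp_nat_mul]
  simp only [Finset.sum_apply] at h1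
  convert h1 using 3
  ring

/-- The sums of iid variables with exponential moments over all late windows of at least
logarithmic length do not exceed their expectation by much. -/
lemma exists_ae_window_sum_le {f : α → ℝ} (hf : Measurable f)
    (hfe : 0 ∈ interior (integrableExpSet f π)) {c : ℝ} (hc : ∫ a, f a ∂π < c) :
    ∃ K : ℝ, 0 ≤ K ∧ ∀ᵐ ω ∂(Measure.infinitePi fun _ : ℕ => π), ∃ n₀ : ℕ, ∀ n m : ℕ, n₀ ≤ n →
      n ≤ m → K * Real.log (n + 1) ≤ m - n → ∑ i ∈ Finset.Ico n m, f (ω i) ≤ c * (m - n) := by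
  obtain ⟨l, hl, hfl, hlt⟩ := exists_exp_mul_mgf_lt_one hfe hc
  have hθ0 : 0 < Real.exp (-l * c) * mgf f π l := mul_pos (Real.exp_pos _) (mgf_pos hfl)
  have hbound := measureReal_window_le hf hl hfl c
  set θ := Real.exp (-l * c) * mgf f π l
  have hlθ : Real.log θ < 0 := Real.log_neg hθ0 hlt
  have hlθ' : 0 < -Real.log θ := neg_pos.2 hlθ
  -- Half of the exponent in `θ ^ k` is kept as the geometric factor `q ^ k`; the other half is at
  -- most `(n + 1) ^ (-2)` once `k ≥ K log (n + 1)`.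
  set K := 4 / (-Real.log θ) with hK
  refine ⟨K, (by positivity), ?_⟩
  set q := Real.exp (Real.log θ / 2) with hq
  have hqsum : Summable fun p : ℕ × ℕ => (1 / ((p.1 : ℝ) + 1) ^ 2) * q ^ p.2 := by
    refine Summable.mul_of_nonneg (f := fun n : ℕ => 1 / ((n : ℝ) + 1) ^ 2)
      (g := fun k : ℕ => q ^ k) ?_ (summable_geometric_of_lt_one (Real.exp_pos _).le
      (Real.exp_lt_one_iff.2 (by linarith))) (fun n => by simp only [Pi.zero_apply]; positivity)
      (fun k => by simp only [Pi.zero_apply]; positivity)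
    exact_mod_cast (summable_nat_add_iff (f := fun n : ℕ => 1 / (n : ℝ) ^ 2) 1).2
      (Real.summable_one_div_nat_pow.2 one_lt_two)
  set s : ℕ × ℕ → Set (ℕ → α) := fun p => {ω | K * Real.log (p.1 + 1) ≤ p.2 ∧
    c * p.2 ≤ ∑ i ∈ Finset.Ico p.1 (p.1 + p.2), f (ω i)} with hs
  have hsle : ∀ p, (Measure.infinitePi fun _ : ℕ => π) (s p) ≤
      ENNReal.ofReal ((1 / ((p.1 : ℝ) + 1) ^ 2) * q ^ p.2) := by
    rintro ⟨n, k⟩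
    by_cases hk : K * Real.log (n + 1) ≤ k
    · refine (measure_mono (t := {ω | c * k ≤ ∑ i ∈ Finset.Ico n (n + k), f (ω i)})
        fun ω hω => hω.2).trans ?_
      rw [← ofReal_measureReal]
      refine ENNReal.ofReal_le_ofReal ((hbound n k).trans ?_)
      have hn : (0 : ℝ) < n + 1 := by positivity
      have h1 : 1 / ((n : ℝ) + 1) ^ 2 = Real.exp (-(2 * Real.log (n + 1))) := by
        rw [Real.exp_neg, mul_comm, Real.exp_mul, Real.exp_log hn, one_div]; norm_cast
      have h2 : θ ^ k = Real.exp (k * Real.log θ) := by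
        rw [Real.exp_nat_mul, Real.exp_log hθ0]
      rw [h1, h2, hq, ← Real.exp_nat_mul, ← Real.exp_add, Real.exp_le_exp]
      rw [hK, div_mul_eq_mul_div, div_le_iff₀ hlθ'] at hk
      linarith
    · have : s (n, k) = ∅ := by
        ext ω; simp only [hs, mem_ofPred_eq, mem_empty_iff_false, iff_false]; exact fun h => hk h.1
      rw [this, measure_empty]; exact zero_le
  have hfin : ∑' p, (Measure.infinitePi fun _ : ℕ => π) (s p) ≠ ⊤ :=
    ne_top_of_le_ne_top hqsum.tsum_ofReal_ne_top (ENNReal.tsum_le_tsum hsle)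
  filter_upwards [ae_finite_setOfPred_mem hfin] with ω hω
  obtain ⟨N, hN⟩ := (hω.image Prod.fst).bddAbove
  refine ⟨N + 1, fun n m hn hnm hk => ?_⟩
  obtain ⟨k, rfl⟩ := Nat.exists_eq_add_of_le hnm
  have e : ((n + k : ℕ) : ℝ) - n = k := by push_cast; ring
  rw [e] at hk ⊢
  by_contra! hlt
  have : n ≤ N := hN ⟨(n, k), ⟨hk, hlt.le⟩, rfl⟩
  omega

/-! ### Long runs -/

lemma measure_run {E : Set α} (hE : MeasurableSet E) (s : Finset ℕ) :
    (Measure.infinitePi fun _ : ℕ => π) {ω | ∀ k ∈ s, ω k ∈ E} = π E ^ s.card := by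
  have : {ω : ℕ → α | ∀ k ∈ s, ω k ∈ E} = (s : Set ℕ).pi fun _ => E := by ext; simp [Set.mem_pi]
  rw [this, Measure.infinitePi_pi _ fun _ _ => hE, Finset.prod_const]

lemma measurableSet_run {E : Set α} (hE : MeasurableSet E) (s : Finset ℕ) :
    MeasurableSet {ω : ℕ → α | ∀ k ∈ s, ω k ∈ E} := by
  simp only [ofPred_forall]
  exact Finset.measurableSet_biInter s fun k _ => measurable_pi_apply k hE

/-- Runs on disjoint blocks of coordinates are independent, so the second Borel–Cantelli lemma
applies. -/
lemma ae_frequently_run {E : Set α} (hE : MeasurableSet E) {s : ℕ → Finset ℕ}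
    (hs : Pairwise (Function.onFun Disjoint s)) (hsum : ∑' j, π E ^ (s j).card = ⊤) :
    ∀ᵐ ω ∂(Measure.infinitePi fun _ : ℕ => π), ∃ᶠ j in atTop, ∀ k ∈ s j, ω k ∈ E := by
  have hm := fun j => measurableSet_run hE (s j)
  have h := measure_limsup_eq_one (μ := Measure.infinitePi fun _ : ℕ => π) hm ?_
    (by simpa only [measure_run hE] using hsum)
  · have hmem := (mem_ae_iff_prob_eq_one (MeasurableSet.measurableSet_limsup hm)).2 h
    filter_upwards [hmem] with ω hω
    exact mem_limsup_iff_frequently_mem.1 hω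
  · rw [iIndepSet_iff_meas_biInter hm]
    intro t
    have : ⋂ j ∈ t, {ω : ℕ → α | ∀ k ∈ s j, ω k ∈ E} = {ω | ∀ k ∈ t.biUnion s, ω k ∈ E} := by
      ext ω; simp; exact ⟨fun h k j hj hk => h j hj k hk, fun h j hj k hk => h k j hj hk⟩
    rw [this, measure_run hE, Finset.card_biUnion fun i _ j _ hij => hs hij,
      ← Finset.prod_pow_eq_pow_sum]
    simp_rw [measure_run hE]

/-- An event of positive probability occurs infinitely often in runs of logarithmic length. -/
lemma exists_ae_frequently_run {E : Set α} (hE : MeasurableSet E) (hpos : π E ≠ 0) :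
    ∃ κ : ℝ, 0 < κ ∧ ∀ᵐ ω ∂(Measure.infinitePi fun _ : ℕ => π), ∀ B : ℕ, ∃ n m : ℕ, B ≤ n ∧
      n + κ * Real.log n ≤ m ∧ ∀ k ∈ Finset.Ico n m, ω k ∈ E := by
  set q := π.real E with hq
  have hq0 : 0 < q := ENNReal.toReal_pos hpos (measure_ne_top _ _)
  have hq1 : q ≤ 1 := measureReal_le_one
  have hlq : Real.log q ≤ 0 := Real.log_nonpos hq0.le hq1
  -- This gives `-2 * κ * log q ≤ 1`, so a run of length about `2 * κ * log j` has probability at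
  -- least `q / j`, a divergent series. The summand `1` covers `q = 1` and forces `κ ≤ 1 / 2`.
  set κ := 1 / (2 * (1 - Real.log q)) with hκ
  have hκ0 : 0 < κ := by rw [hκ]; apply one_div_pos.2; linarith
  have hκ1 : κ ≤ 1 / 2 := by
    rw [hκ]; exact one_div_le_one_div_of_le two_pos (by linarith)
  have hκq : 2 * κ * (1 - Real.log q) = 1 := by
    have : 1 - Real.log q ≠ 0 := by linarith
    rw [hκ]; field_simp
  refine ⟨κ, hκ0, ?_⟩
  set L : ℕ → ℕ := fun j => ⌈κ * Real.log ((j ^ 2 : ℕ) : ℝ)⌉₊ with hL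
  have hLlog : ∀ j, κ * Real.log ((j ^ 2 : ℕ) : ℝ) = 2 * κ * Real.log j := fun j => by
    push_cast; rw [Real.log_pow]; push_cast; ring
  have hlj : ∀ j : ℕ, 0 ≤ Real.log j := fun j => Real.log_natCast_nonneg j
  have hLlt : ∀ j, (L j : ℝ) < 2 * κ * Real.log j + 1 := fun j => by
    rw [← hLlog]; exact Nat.ceil_lt_add_one (by rw [hLlog]; have := hlj j; positivity)
  have hLle : ∀ j, L j ≤ 2 * j + 1 := fun j => by
    have h1 : Real.log j ≤ j := Real.log_le_self (Nat.cast_nonneg j)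
    have h2 : (L j : ℝ) < 2 * j + 1 := by nlinarith [hLlt j, hlj j]
    exact_mod_cast h2.le
  -- Starting at squares leaves gaps of `2 * j + 1`, enough for disjoint blocks, and changes `log`
  -- only by a factor `2`.
  set s : ℕ → Finset ℕ := fun j => Finset.Ico (j ^ 2) (j ^ 2 + L j) with hs
  have hdisj : ∀ i j, i < j → Disjoint (s i) (s j) := fun i j hij => by
    rw [Finset.disjoint_left]
    intro k hi hj
    simp only [hs, Finset.mem_Ico] at hi hj
    have := hLle i
    nlinarith
  have hpair : Pairwise (Function.onFun Disjoint s) := fun i j hij => by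
    rcases lt_or_gt_of_ne hij with h | h
    · exact hdisj i j h
    · exact (hdisj j i h).symm
  have hge : ∀ j : ℕ, 1 ≤ j → q * (1 / (j : ℝ)) ≤ q ^ (s j).card := fun j hj => by
    have hj0 : (0 : ℝ) < j := by exact_mod_cast hj
    have h2 : q ^ L j = Real.exp (L j * Real.log q) := by rw [Real.exp_nat_mul, Real.exp_log hq0]
    have h1 : q * (1 / (j : ℝ)) = Real.exp (Real.log q + -Real.log j) := by
      rw [Real.exp_add, Real.exp_neg, Real.exp_log hq0, Real.exp_log hj0, one_div]
    rw [hs, Nat.card_Ico, Nat.add_sub_cancel_left, h1, h2, Real.exp_le_exp]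
    have h3 := mul_le_mul_of_nonpos_right (hLlt j).le hlq
    nlinarith [hlj j, mul_nonneg hκ0.le (hlj j)]
  have hsum : ∑' j, π E ^ (s j).card = ⊤ := by
    by_contra hne
    have hcoe : ∀ j, π E ^ (s j).card = ENNReal.ofReal (q ^ (s j).card) := fun j => by
      rw [ENNReal.ofReal_pow hq0.le, hq, ofReal_measureReal]
    have h1 : Summable fun j => q ^ (s j).card := by
      have h2 := ENNReal.summable_toReal hne
      simpa [hcoe, ENNReal.toReal_ofReal, hq0.le] using h2
    have h2 : Summable fun j : ℕ => q * (1 / (j : ℝ)) := by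
      refine Summable.of_nonneg_of_le (fun j => by positivity) (fun j => ?_) h1
      rcases Nat.eq_zero_or_pos j with rfl | hj
      · simp; positivity
      · exact hge j hj
    exact Real.not_summable_one_div_natCast ((summable_mul_left_iff hq0.ne').1 h2)
  filter_upwards [ae_frequently_run hE hpair hsum] with ω hω B
  obtain ⟨j, hj, hjE⟩ := (frequently_atTop.1 hω) B
  refine ⟨j ^ 2, j ^ 2 + L j, le_trans hj (Nat.le_self_pow two_ne_zero j), ?_, hjE⟩
  have := Nat.le_ceil (κ * Real.log ((j ^ 2 : ℕ) : ℝ))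
  rw [Nat.cast_add]
  gcongr

end IID

end RandomMoran

end

noncomputable section

namespace RandomMoran

open ProbabilityTheory

variable {D : ℕ} {S : Setup D}

/-! ### Measurability and integrability -/

lemma measurable_of_forall_comp_mk {β : Type*} [MeasurableSpace β] {f : Choice S → β}
    (hf : ∀ t : {t : ℕ // 2 ≤ t},
      Measurable fun b : Ioc (0 : ℝ) (S.rMax t) × openSimplex t => f ⟨t, b⟩) :
    Measurable f := fun _ hs => MeasurableSpace.measurableSet_iInf.2 fun t => hf t hs

lemma measurable_absLogMax : Measurable (fun a : Choice S => absLogMax a) := by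
  refine measurable_of_forall_comp_mk fun t => ?_
  have h (k : Fin t) : Measurable fun b : Ioc (0 : ℝ) (S.rMax t) × openSimplex t => b.2.1 k :=
    (measurable_pi_apply k).comp (measurable_subtype_coe.comp measurable_snd)
  exact (Real.measurable_log.comp (Measurable.iSup h)).abs

lemma measurable_absLogMin : Measurable (fun a : Choice S => absLogMin a) := by
  refine measurable_of_forall_comp_mk fun t => ?_
  have h (k : Fin t) : Measurable fun b : Ioc (0 : ℝ) (S.rMax t) × openSimplex t => b.2.1 k :=
    (measurable_pi_apply k).comp (measurable_subtype_coe.comp measurable_snd)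
  exact (Real.measurable_log.comp (Measurable.iInf h)).abs

/-- Packing: points chosen in distinct members of the family are at least `τ * r` apart, so each
ball of a finite cover of `I₀` by balls of radius `τ * r / 2` contains at most one. -/
lemma exists_num_le (S : Setup D) {r : ℝ} (hr : 0 < r) :
    ∃ N : ℕ, ∀ a : Choice S, ratio a = r → num a ≤ N := by
  obtain ⟨t, ht, hcov⟩ := Metric.totallyBounded_iff.1 S.isCompact.totallyBounded
    (S.τ * r / 2) (by have := S.τ_pos; positivity)
  refine ⟨ht.toFinset.card, fun a ha => ?_⟩
  obtain ⟨J, hJ⟩ := S.separation (num a) a.1.2 (ratio a) (ratio_pos a) a.2.1.2.2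
  have hne : ∀ i, ∃ y, y ∈ J i := fun i => by
    obtain ⟨f, -, hf⟩ := hJ.similar i
    exact hf ▸ (Moran.I₀_nonempty S).image f
  choose y hy using hne
  have hc : ∀ i, ∃ z ∈ t, dist (y i) z < S.τ * r / 2 := fun i => by
    simpa using hcov (hJ.subset i (hy i))
  choose z hz hyz using hc
  have hinj : Function.Injective z := fun i j hij => by
    by_contra hne
    have h := hJ.separated i j hne (y i) (hy i) (y j) (hy j)
    rw [S.diam_eq, mul_one, ha] at h
    have h2 := dist_triangle_right (y i) (y j) (z i)
    have h3 := hyz j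
    rw [← hij] at h3
    linarith [hyz i]
  have := Finset.card_le_card_of_injOn (s := Finset.univ) (t := ht.toFinset) z
    (fun i _ => by simpa using hz i) hinj.injOn
  simpa using this

/-- The largest of `T` numbers with sum `1` is at least `1 / T`. -/
lemma absLogMax_le_log_num (a : Choice S) : absLogMax a ≤ Real.log (num a) := by
  have hn : (0 : ℝ) < num a := by have := two_le_num a; exact_mod_cast (by omega : 0 < num a)
  obtain ⟨k, -, hk⟩ := Finset.exists_le_of_sum_le (s := Finset.univ) (f := fun _ => (num a : ℝ)⁻¹)
    (g := prob a) Finset.univ_nonempty (by simp [sum_prob, hn.ne'])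
  refine (absLogMax_le a k).trans ?_
  rw [neg_le, ← Real.log_inv]
  exact Real.log_le_log (inv_pos.2 hn) hk

section

variable {π : Measure (Choice S)} [IsProbabilityMeasure π] {r : ℝ}

lemma ratio_mem_Ioo (hr : ∀ᵐ a ∂π, ratio a = r) : r ∈ Ioo (0 : ℝ) 1 := by
  obtain ⟨a, rfl⟩ := hr.exists
  exact ⟨ratio_pos a, (ratio_le a).trans_lt (by norm_num)⟩

lemma exists_ae_absLogMax_le (hr : ∀ᵐ a ∂π, ratio a = r) :
    ∃ C : ℝ, ∀ᵐ a ∂π, absLogMax a ≤ C := by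
  obtain ⟨N, hN⟩ := exists_num_le S (ratio_mem_Ioo hr).1
  refine ⟨Real.log N, ?_⟩
  filter_upwards [hr] with a ha
  refine (absLogMax_le_log_num a).trans (Real.log_le_log ?_ (by exact_mod_cast hN a ha))
  have := two_le_num a; exact_mod_cast (by omega : 0 < num a)

lemma integrable_absLogMax (hr : ∀ᵐ a ∂π, ratio a = r) :
    Integrable absLogMax π := by
  obtain ⟨C, hC⟩ := exists_ae_absLogMax_le hr
  refine Integrable.of_bound measurable_absLogMax.aestronglyMeasurable C ?_
  filter_upwards [hC] with a ha
  rwa [Real.norm_of_nonneg (absLogMax_nonneg a)]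

lemma integrable_exp_mul_absLogMax (hr : ∀ᵐ a ∂π, ratio a = r) (l : ℝ) :
    Integrable (fun a => Real.exp (l * absLogMax a)) π := by
  obtain ⟨C, hC⟩ := exists_ae_absLogMax_le hr
  refine Integrable.of_bound
    (measurable_absLogMax.const_mul l).exp.aestronglyMeasurable (Real.exp (|l| * C)) ?_
  filter_upwards [hC] with a ha
  rw [Real.norm_of_nonneg (Real.exp_pos _).le, Real.exp_le_exp]
  exact (mul_le_mul_of_nonneg_right (le_abs_self l) (absLogMax_nonneg a)).trans
    (mul_le_mul_of_nonneg_left ha (abs_nonneg l))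

lemma ae_forall_apply {p : Choice S → Prop} (hp : ∀ᵐ a ∂π, p a) :
    ∀ᵐ ω ∂(productLaw π), ∀ n, p (ω n) :=
  ae_all_iff.2 fun n =>
    (measurePreserving_eval_infinitePi (fun _ : ℕ => π) n).quasiMeasurePreserving.ae hp

/-! ### Large dimension functions -/

/-- The sums of `f` over late windows of at least logarithmic length are eventually at most `c`
times the length, for every `c > e`. -/
def WindowSumsLE (ω : ℕ → Choice S) (f : Choice S → ℝ) (e : ℝ) : Prop :=
  ∀ c : ℝ, e < c → ∃ K : ℝ, 0 ≤ K ∧ ∃ n₀ : ℕ, ∀ n m : ℕ, n₀ ≤ n → n ≤ m →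
    K * Real.log (n + 1) ≤ m - n → ∑ i ∈ Finset.Ico n m, f (ω i) ≤ c * (m - n)

/-- Rational levels make the exceptional set independent of `c`. -/
lemma ae_windowSumsLE {f : Choice S → ℝ} (hf : Measurable f)
    (hfe : 0 ∈ interior (integrableExpSet f π)) :
    ∀ᵐ ω ∂(productLaw π), WindowSumsLE ω f (∫ a, f a ∂π) := by
  have h : ∀ q : ℚ, ∀ᵐ ω ∂(productLaw π), ∫ a, f a ∂π < q → ∃ K : ℝ, 0 ≤ K ∧ ∃ n₀ : ℕ,
      ∀ n m : ℕ, n₀ ≤ n → n ≤ m → K * Real.log (n + 1) ≤ m - n →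
        ∑ i ∈ Finset.Ico n m, f (ω i) ≤ q * (m - n) := fun q => by
    refine eventually_imp_distrib_left.2 fun hq => ?_
    obtain ⟨K, hK, hω⟩ := exists_ae_window_sum_le hf hfe hq
    exact hω.mono fun ω hω => ⟨K, hK, hω⟩
  filter_upwards [ae_all_iff.2 h] with ω hω c hc
  obtain ⟨q, hq, hqc⟩ := exists_rat_btwn hc
  obtain ⟨K, hK, n₀, H⟩ := hω q hq
  refine ⟨K, hK, n₀, fun n m hn hnm hk => (H n m hn hnm hk).trans ?_⟩
  have : (n : ℝ) ≤ m := by exact_mod_cast hnm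
  exact mul_le_mul_of_nonneg_right hqc.le (by linarith)

/-- For a large `Φ`, the inequality that needs only suitable windows is obtained by fixing `n` and
letting `m` grow, whatever the size of `Φ` at that radius. -/
lemma exists_late_window {r : ℝ} (hr : 0 < r) (hr1 : r < 1) (n B : ℕ) (a : ℝ) (K : ℝ)
    {x : ℝ} (hx : 0 < x) : ∃ m : ℕ, n + B ≤ m ∧ a * r ^ m < x ∧ K ≤ (m : ℝ) - n := by
  have h1 : Tendsto (fun m : ℕ => a * r ^ m) atTop (𝓝 0) := by
    simpa using (tendsto_pow_atTop_nhds_zero_of_lt_one hr.le hr1).const_mul a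
  have h2 : Tendsto (fun m : ℕ => (m : ℝ) - n) atTop atTop :=
    tendsto_atTop_add_const_right _ _ tendsto_natCast_atTop_atTop
  obtain ⟨m, h1, h2, h3⟩ := ((eventually_ge_atTop (n + B)).and
    ((h1.eventually_lt_const hx).and (h2.eventually_ge_atTop K))).exists
  exact ⟨m, h1, h2, h3⟩

namespace Moran

variable {ω : ℕ → Choice S} (M : Moran S ω)

lemma lowerPhiDim_eq_of_isLarge (hr : 0 < r) (hr1 : r < 1) (hω : ∀ n, ratio (ω n) = r) {e : ℝ}
    (h₁ : WindowSumsLE ω absLogMax e) (h₂ : WindowSumsLE ω (fun a => -absLogMax a) (-e))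
    {Φ : ℝ → ℝ} (hΦ : IsLarge Φ) :
    lowerPhiDim Φ M.measure = ((e / |Real.log r| : ℝ) : EReal) := by
  have hτ := S.τ_pos
  have hl : 0 < |Real.log r| := abs_pos.2 (Real.log_neg hr hr1).ne
  refine le_antisymm (EReal.le_of_forall_lt_iff_le.1 fun z hz => ?_)
    (EReal.ge_of_forall_gt_iff_ge.1 fun z hz => ?_)
  · rw [EReal.coe_lt_coe_iff, div_lt_iff₀ hl] at hz
    obtain ⟨K, hK, n₀, H⟩ := h₁ _ hz
    rw [← mul_div_cancel_right₀ z hl.ne']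
    refine M.lowerPhiDim_le hr hr1 hω hΦ.1 fun B => ?_
    obtain ⟨m, h3, h4, h5⟩ := exists_late_window hr hr1 (max n₀ B) B 2
      (K * Real.log ((max n₀ B : ℕ) + 1))
      (Real.rpow_pos_of_pos (mul_pos hτ (pow_pos hr (max n₀ B))) (1 + Φ (S.τ * r ^ max n₀ B)))
    exact ⟨max n₀ B, m, le_max_right _ _, h3, h4,
      H _ m (le_max_left _ _) ((Nat.le_add_right _ _).trans h3) h5⟩
  · rw [EReal.coe_lt_coe_iff, lt_div_iff₀ hl] at hz
    rcases lt_or_ge z 0 with hz0 | hz0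
    -- The window criterion needs `d ≥ 0`; negative exponents are covered because `0` is always
    -- admissible.
    · exact le_trans (by exact_mod_cast hz0.le) M.zero_le_lowerPhiDim
    obtain ⟨K, hK, n₀, H⟩ := h₂ _ (neg_lt_neg hz)
    obtain ⟨C₁, hC₁, hC⟩ := hΦ.exists_forall_window hr hr1 (mul_pos hτ hr) (inv_pos.2 hr) hK n₀
    refine M.le_lowerPhiDim hr hr1 hω hz0 hC₁ fun R ρ n m h1 h2 h3 h4 hnm h5 h6 h7 => ?_
    obtain ⟨hn, hk⟩ := hC R ρ n m h1 h2 h3 h4 h5 h6 h7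
    have := H n m hn hnm hk
    rw [Finset.sum_neg_distrib] at this
    linarith

lemma upperPhiDim_eq_of_isLarge (hr : 0 < r) (hr1 : r < 1) (hω : ∀ n, ratio (ω n) = r) {e : ℝ}
    (he : 0 ≤ e) (h₁ : WindowSumsLE ω absLogMin e)
    (h₂ : WindowSumsLE ω (fun a => -absLogMin a) (-e)) {Φ : ℝ → ℝ} (hΦ : IsLarge Φ) :
    upperPhiDim Φ M.measure = ((e / |Real.log r| : ℝ) : EReal) := by
  have hτ := S.τ_pos
  have hl : 0 < |Real.log r| := abs_pos.2 (Real.log_neg hr hr1).ne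
  refine le_antisymm (EReal.le_of_forall_lt_iff_le.1 fun z hz => ?_)
    (EReal.ge_of_forall_gt_iff_ge.1 fun z hz => ?_)
  · rw [EReal.coe_lt_coe_iff] at hz
    have hz0 : 0 ≤ z := (div_nonneg he hl.le).trans hz.le
    rw [div_lt_iff₀ hl] at hz
    obtain ⟨K, hK, n₀, H⟩ := h₁ _ hz
    obtain ⟨C₁, hC₁, hC⟩ := hΦ.exists_forall_window hr hr1 (mul_pos hτ hr) (inv_pos.2 hr) hK n₀
    refine M.upperPhiDim_le hr hr1 hω hz0 hC₁ fun R ρ n m h1 h2 h3 h4 hnm h5 h6 h7 => ?_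
    obtain ⟨hn, hk⟩ := hC R ρ n m h1 h2 h3 h4 h5 h6 h7
    exact H n m hn hnm hk
  · rw [EReal.coe_lt_coe_iff, lt_div_iff₀ hl] at hz
    obtain ⟨K, hK, n₀, H⟩ := h₂ _ (neg_lt_neg hz)
    rw [← mul_div_cancel_right₀ z hl.ne']
    refine M.le_upperPhiDim hr hr1 hω hΦ.1 fun B => ?_
    obtain ⟨m, h3, h4, h5⟩ := exists_late_window hr hr1 (max n₀ B) B S.τ
      (K * Real.log ((max n₀ B : ℕ) + 1))
      (Real.rpow_pos_of_pos (mul_pos two_pos (pow_pos hr (max n₀ B)))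
        (1 + Φ (2 * r ^ max n₀ B)))
    refine ⟨max n₀ B, m, le_max_right _ _, h3, h4, ?_⟩
    have := H _ m (le_max_left _ _) ((Nat.le_add_right _ _).trans h3) h5
    rw [Finset.sum_neg_distrib] at this
    linarith

end Moran

/-! ### Small dimension functions -/

/-- There are arbitrarily late runs, of at least logarithmic length, in which `p` holds. -/
def HasLongRuns (ω : ℕ → Choice S) (p : Choice S → Prop) : Prop :=
  ∃ κ : ℝ, 0 < κ ∧ ∀ B : ℕ, ∃ n m : ℕ, B ≤ n ∧ n + κ * Real.log n ≤ m ∧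
    ∀ k ∈ Finset.Ico n m, p (ω k)

lemma ae_hasLongRuns {p : Choice S → Prop} (hp : MeasurableSet {a | p a})
    (hpos : ∃ᶠ a in ae π, p a) : ∀ᵐ ω ∂(productLaw π), HasLongRuns ω p := by
  obtain ⟨κ, hκ, h⟩ := exists_ae_frequently_run hp (frequently_ae_iff.1 hpos)
  exact h.mono fun ω hω => ⟨κ, hκ, hω⟩

lemma HasLongRuns.exists_window {ω : ℕ → Choice S} {p : Choice S → Prop} (h : HasLongRuns ω p)
    (hr : 0 < r) (hr1 : r < 1) {Φ : ℝ → ℝ} (hΦ : IsSmall Φ) {a b : ℝ} (ha : 0 < a) (hb : 0 < b)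
    (B : ℕ) : ∃ n m : ℕ, B ≤ n ∧ n + B ≤ m ∧ a * r ^ m < (b * r ^ n) ^ (1 + Φ (b * r ^ n)) ∧
      ∀ k ∈ Finset.Ico n m, p (ω k) := by
  obtain ⟨κ, hκ, H⟩ := h
  have hlog : Tendsto (fun n : ℕ => κ * Real.log n) atTop atTop :=
    (Real.tendsto_log_atTop.comp tendsto_natCast_atTop_atTop).const_mul_atTop hκ
  obtain ⟨N, hN⟩ := eventually_atTop.1
    ((hΦ.eventually_lt_rpow hr hr1 ha hb hκ).and (hlog.eventually_ge_atTop (B : ℝ)))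
  obtain ⟨n, m, h1, h2, h3⟩ := H (max N B)
  obtain ⟨h4, h5⟩ := hN n ((le_max_left _ _).trans h1)
  refine ⟨n, m, (le_max_right _ _).trans h1, ?_, h4 m h2, h3⟩
  exact_mod_cast (by linarith : (n : ℝ) + B ≤ m)

namespace Moran

variable {ω : ℕ → Choice S} (M : Moran S ω)

lemma lowerPhiDim_eq_of_isSmall (hr : 0 < r) (hr1 : r < 1) (hω : ∀ n, ratio (ω n) = r)
    {e : EReal} (h₁ : ∀ q : ℚ, (((q : ℝ)) : EReal) < e → ∀ n, q < absLogMax (ω n))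
    (h₂ : ∀ q : ℚ, e < ((q : ℝ) : EReal) → HasLongRuns ω fun a => absLogMax a < q)
    {Φ : ℝ → ℝ} (hΦ : IsSmall Φ) :
    lowerPhiDim Φ M.measure = e / (|Real.log r| : ℝ) := by
  have hτ := S.τ_pos
  have hl : 0 < |Real.log r| := abs_pos.2 (Real.log_neg hr hr1).ne
  have hl' : (0 : EReal) < (|Real.log r| : ℝ) := by exact_mod_cast hl
  refine le_antisymm (EReal.le_of_forall_lt_iff_le.1 fun z hz => ?_)
    (EReal.ge_of_forall_gt_iff_ge.1 fun z hz => ?_)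
  · rw [EReal.div_lt_iff hl' (EReal.coe_ne_top _), ← EReal.coe_mul] at hz
    obtain ⟨q, hq, hqz⟩ := EReal.lt_iff_exists_rat_btwn.1 hz
    rw [← mul_div_cancel_right₀ z hl.ne']
    refine M.lowerPhiDim_le hr hr1 hω hΦ.1 fun B => ?_
    obtain ⟨n, m, h3, h4, h5, h6⟩ := (h₂ q hq).exists_window hr hr1 hΦ two_pos hτ B
    refine ⟨n, m, h3, h4, h5, ?_⟩
    have hqz : (q : ℝ) < z * |Real.log r| := by exact_mod_cast hqz
    have := Finset.sum_le_card_nsmul _ _ _ fun k hk => ((h6 k hk).trans hqz).le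
    rwa [Nat.card_Ico, nsmul_eq_mul, Nat.cast_sub (by omega), mul_comm] at this
  · rcases lt_or_ge z 0 with hz0 | hz0
    · exact le_trans (by exact_mod_cast hz0.le) M.zero_le_lowerPhiDim
    rw [EReal.lt_div_iff hl' (EReal.coe_ne_top _), ← EReal.coe_mul] at hz
    obtain ⟨q, hzq, hq⟩ := EReal.lt_iff_exists_rat_btwn.1 hz
    have hzq : z * |Real.log r| < q := by exact_mod_cast hzq
    refine M.le_lowerPhiDim hr hr1 hω hz0 one_pos fun R ρ n m _ _ _ _ hnm _ _ _ => ?_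
    have := Finset.card_nsmul_le_sum (Finset.Ico n m) _ _ fun k _ => (hzq.trans (h₁ q hq k)).le
    rwa [Nat.card_Ico, nsmul_eq_mul, Nat.cast_sub hnm, mul_comm] at this

lemma upperPhiDim_eq_of_isSmall (hr : 0 < r) (hr1 : r < 1) (hω : ∀ n, ratio (ω n) = r)
    {e : EReal} (h₁ : ∀ q : ℚ, e < ((q : ℝ) : EReal) → ∀ n, absLogMin (ω n) < q)
    (h₂ : ∀ q : ℚ, ((q : ℝ) : EReal) < e → HasLongRuns ω fun a => (q : ℝ) < absLogMin a)
    {Φ : ℝ → ℝ} (hΦ : IsSmall Φ) :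
    upperPhiDim Φ M.measure = e / (|Real.log r| : ℝ) := by
  have hτ := S.τ_pos
  have hl : 0 < |Real.log r| := abs_pos.2 (Real.log_neg hr hr1).ne
  have hl' : (0 : EReal) < (|Real.log r| : ℝ) := by exact_mod_cast hl
  refine le_antisymm (EReal.le_of_forall_lt_iff_le.1 fun z hz => ?_)
    (EReal.ge_of_forall_gt_iff_ge.1 fun z hz => ?_)
  · rw [EReal.div_lt_iff hl' (EReal.coe_ne_top _), ← EReal.coe_mul] at hz
    obtain ⟨q, hq, hqz⟩ := EReal.lt_iff_exists_rat_btwn.1 hz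
    have hqz : (q : ℝ) < z * |Real.log r| := by exact_mod_cast hqz
    -- If `e = ⊤`, no such `q` exists and this half is vacuous; otherwise `Y ≥ 0` makes `z`
    -- nonnegative.
    have hz0 : 0 ≤ z := (pos_of_mul_pos_left
      (((absLogMin_nonneg _).trans_lt (h₁ q hq 0)).trans hqz) hl.le).le
    refine M.upperPhiDim_le hr hr1 hω hz0 one_pos fun R ρ n m _ _ _ _ hnm _ _ _ => ?_
    have := Finset.sum_le_card_nsmul (Finset.Ico n m) _ _ fun k _ => ((h₁ q hq k).trans hqz).le
    rwa [Nat.card_Ico, nsmul_eq_mul, Nat.cast_sub hnm, mul_comm] at this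
  · rw [EReal.lt_div_iff hl' (EReal.coe_ne_top _), ← EReal.coe_mul] at hz
    obtain ⟨q, hzq, hq⟩ := EReal.lt_iff_exists_rat_btwn.1 hz
    have hzq : z * |Real.log r| < q := by exact_mod_cast hzq
    rw [← mul_div_cancel_right₀ z hl.ne']
    refine M.le_upperPhiDim hr hr1 hω hΦ.1 fun B => ?_
    obtain ⟨n, m, h3, h4, h5, h6⟩ := (h₂ q hq).exists_window hr hr1 hΦ hτ two_pos B
    refine ⟨n, m, h3, h4, h5, ?_⟩
    have := Finset.card_nsmul_le_sum _ _ _ fun k hk => (hzq.trans (h6 k hk)).le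
    rwa [Nat.card_Ico, nsmul_eq_mul, Nat.cast_sub (by omega), mul_comm] at this

end Moran

end

end RandomMoran

end

/-! ### Assembly of the almost sure events -/

theorem mainTheorem5 {D : ℕ} (S : RandomMoran.Setup D)
    (π : Measure (RandomMoran.Choice S)) [IsProbabilityMeasure π]
    (r : ℝ) (hr : ∀ᵐ a ∂π, RandomMoran.ratio a = r) :
    -- large `Φ`, lower dimension
    (Integrable RandomMoran.absLogMax π ∧
      ∀ᵐ ω ∂(RandomMoran.productLaw π), ∀ M : RandomMoran.Moran S ω, ∀ Φ : ℝ → ℝ,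
        RandomMoran.IsLarge Φ →
          RandomMoran.lowerPhiDim Φ M.measure
            = (((∫ a, RandomMoran.absLogMax a ∂π) / |Real.log r| : ℝ) : EReal)) ∧
    -- large `Φ`, upper dimension
    ((∃ A : ℝ, 0 < A ∧ ∀ l : ℝ, |l| ≤ A →
        Integrable (fun a => Real.exp (l * RandomMoran.absLogMin a)) π) →
      Integrable RandomMoran.absLogMin π ∧
      ∀ᵐ ω ∂(RandomMoran.productLaw π), ∀ M : RandomMoran.Moran S ω, ∀ Φ : ℝ → ℝ,
        RandomMoran.IsLarge Φ →
          RandomMoran.upperPhiDim Φ M.measure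
            = (((∫ a, RandomMoran.absLogMin a ∂π) / |Real.log r| : ℝ) : EReal)) ∧
    -- small `Φ`, both dimensions
    (∀ᵐ ω ∂(RandomMoran.productLaw π), ∀ M : RandomMoran.Moran S ω, ∀ Φ : ℝ → ℝ,
        RandomMoran.IsSmall Φ →
          RandomMoran.lowerPhiDim Φ M.measure
            = essInf (fun a => (RandomMoran.absLogMax a : EReal)) π / (|Real.log r| : ℝ) ∧
          RandomMoran.upperPhiDim Φ M.measure
            = essSup (fun a => (RandomMoran.absLogMin a : EReal)) π / (|Real.log r| : ℝ)) := by
  open RandomMoran in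
  obtain ⟨hr0, hr1⟩ := ratio_mem_Ioo hr
  have hratio := ae_forall_apply hr
  refine ⟨⟨integrable_absLogMax hr, ?_⟩, ?_, ?_⟩
  · have hX : ∀ l : ℝ, |l| ≤ 1 → Integrable (fun a => Real.exp (l * absLogMax a)) π :=
      fun l _ => integrable_exp_mul_absLogMax hr l
    filter_upwards [hratio,
      ae_windowSumsLE measurable_absLogMax (zero_mem_interior_integrableExpSet one_pos hX),
      ae_windowSumsLE measurable_absLogMax.neg
        (zero_mem_interior_integrableExpSet_neg one_pos hX)] with ω hω h₁ h₂ M Φ hΦ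
    simp only [Pi.neg_apply, integral_neg] at h₂
    exact M.lowerPhiDim_eq_of_isLarge hr0 hr1 hω h₁ h₂ hΦ
  · rintro ⟨A, hA, hY⟩
    have hY₀ := zero_mem_interior_integrableExpSet hA hY
    refine ⟨ProbabilityTheory.integrable_of_mem_interior_integrableExpSet hY₀, ?_⟩
    filter_upwards [hratio, ae_windowSumsLE measurable_absLogMin hY₀,
      ae_windowSumsLE measurable_absLogMin.neg
        (zero_mem_interior_integrableExpSet_neg hA hY)] with ω hω h₁ h₂ M Φ hΦ
    simp only [Pi.neg_apply, integral_neg] at h₂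
    exact M.upperPhiDim_eq_of_isLarge hr0 hr1 hω (integral_nonneg absLogMin_nonneg) h₁ h₂ hΦ
  · have a₁ : ∀ q : ℚ, ∀ᵐ ω ∂(productLaw π), ((q : ℝ) : EReal) <
        essInf (fun a => (absLogMax a : EReal)) π → ∀ n, q < absLogMax (ω n) := fun q =>
      eventually_imp_distrib_left.2 fun hq => ae_forall_apply
        ((ae_lt_of_lt_essInf hq).mono fun a ha => EReal.coe_lt_coe_iff.1 ha)
    have a₂ : ∀ q : ℚ, ∀ᵐ ω ∂(productLaw π), essInf (fun a => (absLogMax a : EReal)) π <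
        ((q : ℝ) : EReal) → HasLongRuns ω fun a => absLogMax a < q := fun q =>
      eventually_imp_distrib_left.2 fun hq => ae_hasLongRuns
        (measurableSet_lt measurable_absLogMax measurable_const)
        -- The essential infimum is a `liminf` along `ae π`, so a level above it is undercut on a
        -- set of positive measure.
        ((frequently_lt_of_liminf_lt (by isBoundedDefault) hq).mono
          fun a ha => EReal.coe_lt_coe_iff.1 ha)
    have b₁ : ∀ q : ℚ, ∀ᵐ ω ∂(productLaw π), essSup (fun a => (absLogMin a : EReal)) π <
        ((q : ℝ) : EReal) → ∀ n, absLogMin (ω n) < q := fun q =>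
      eventually_imp_distrib_left.2 fun hq => ae_forall_apply
        ((ae_lt_of_essSup_lt hq).mono fun a ha => EReal.coe_lt_coe_iff.1 ha)
    have b₂ : ∀ q : ℚ, ∀ᵐ ω ∂(productLaw π), ((q : ℝ) : EReal) <
        essSup (fun a => (absLogMin a : EReal)) π →
          HasLongRuns ω fun a => (q : ℝ) < absLogMin a := fun q =>
      eventually_imp_distrib_left.2 fun hq => ae_hasLongRuns
        (measurableSet_lt measurable_const measurable_absLogMin)
        ((frequently_lt_of_lt_limsup (by isBoundedDefault) hq).mono
          fun a ha => EReal.coe_lt_coe_iff.1 ha)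
    filter_upwards [hratio, ae_all_iff.2 a₁, ae_all_iff.2 a₂, ae_all_iff.2 b₁,
      ae_all_iff.2 b₂] with ω hω h₁ h₂ h₃ h₄ M Φ hΦ
    exact ⟨M.lowerPhiDim_eq_of_isSmall hr0 hr1 hω h₁ h₂ hΦ,
      M.upperPhiDim_eq_of_isSmall hr0 hr1 hω h₃ h₄ hΦ⟩
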